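/- Let $n\ge 0$ and $m\ge 1$ be integers, and put $d=\frac{1-(-1)^n}{2}$ and $r=\frac{n-d}{2}$. Let $B_{n+1}$ be the braid group on $n+1$ strands with elementary generators $\sigma_1,\dots,\sigma_n$, and let $$\sigma_{n+1,m}=\left(\sigma_1\sigma_2^{-1}\sigma_3\sigma_4^{-1}\cdots\sigma_n^{\delta}\right)^m,\qquad \delta=1 \text{ if } n \text{ is odd},\quad \delta=-1 \text{ if } n \text{ is even}$$ (the trivial braid if $n=0$). For a field $K$, $0\ne q\in K$ and $i\ge 0$, let $H_{i+1}(q)$ be the unital associative $K$-algebra with generators $T_1,\dots,T_i$ and relations $T_jT_l=T_lT_j$ for $|j-l|\ge 2$, $T_jT_{j+1}T_j=T_{j+1}T_jT_{j+1}$ and $T_j^2=(q-1)T_j+q$. The $T_j$ are invertible; let $\rho$ be the homomorphism from $B_{n+1}$ to the group of units of $H_{n+1}(q)$ with $\rho(\sigma_j)=T_j$. For $z\in K$, let $Tr$ be the (existing and unique) family of $K$-linear maps $H_{i+1}(q)\to K$, $i\ge 0$, compatible with the natural maps $H_i(q)\to H_{i+1}(q)$, such that $Tr(1)=1$, $Tr(ab)=Tr(ba)$,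 and $Tr(aT_ib)=z\,Tr(ab)$ for $i\ge1$ and $a,b\in H_i(q)$. Then $Tr(\rho(\sigma_{n+1,m}))$ is a Laurent polynomial in $q$ and $z$: for every field $k$ there is a Laurent polynomial $P$ in two variables with coefficients in $k$ such that $Tr(\rho(\sigma_{n+1,m}))=P(q,z)$ for all field extensions $K$ of $k$, all $0\ne q\in K$ and all $z\in K$ (with $0^0=1$). Moreover: 1. the largest total degree $a+b$ of a monomial $q^az^b$ that occurs in $P$ is $mn-mr$; 2. the smallest total degree $a+b$ of a monomial $q^az^b$ that occurs in $P$ is $r+d-mr$. -/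

import Mathlib

universe u

noncomputable section

namespace WeavingTrace

/-! Generators are indexed from `0`: the index `i : Fin n` stands for the generator usually
written with subscript `i + 1`. -/

/-- The defining relators of the Artin braid group on `n + 1` strands, in the free group on
`σ₁, …, σₙ`. -/
inductive BraidRelator (n : ℕ) : FreeGroup (Fin n) → Prop
  | far (i j : Fin n) (h : (i : ℕ) + 2 ≤ (j : ℕ)) :
      BraidRelator n (FreeGroup.of i * FreeGroup.of j *
        (FreeGroup.of j * FreeGroup.of i)⁻¹)
  | braid (i j : Fin n) (h : (i : ℕ) + 1 = (j : ℕ)) :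
      BraidRelator n (FreeGroup.of i * FreeGroup.of j * FreeGroup.of i *
        (FreeGroup.of j * FreeGroup.of i * FreeGroup.of j)⁻¹)

/-- The braid group `B_{n+1}` on `n + 1` strands. -/
abbrev BraidGroup (n : ℕ) : Type := PresentedGroup {w | BraidRelator n w}

/-- The elementary braids generating `B_{n+1}`. -/
def sigma {n : ℕ} (i : Fin n) : BraidGroup n := PresentedGroup.of i

/-- The weaving braid `σ_{n+1,m} = (σ₁ σ₂⁻¹ σ₃ σ₄⁻¹ ⋯ σₙ^{±1})^m` in `B_{n+1}`. -/
def weavingBraid (n m : ℕ) : BraidGroup n :=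
  (List.ofFn fun i : Fin n => if Even (i : ℕ) then sigma i else (sigma i)⁻¹).prod ^ m

section Hecke

variable {K : Type*} [Field K]

/-- The defining relations of the Hecke algebra with parameter `q` on `n` generators. -/
inductive HeckeRel (q : K) (n : ℕ) : FreeAlgebra K (Fin n) → FreeAlgebra K (Fin n) → Prop
  | far (i j : Fin n) (h : (i : ℕ) + 2 ≤ (j : ℕ)) :
      HeckeRel q n (FreeAlgebra.ι K i * FreeAlgebra.ι K j)
        (FreeAlgebra.ι K j * FreeAlgebra.ι K i)
  | braid (i j : Fin n) (h : (i : ℕ) + 1 = (j : ℕ)) :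
      HeckeRel q n (FreeAlgebra.ι K i * FreeAlgebra.ι K j * FreeAlgebra.ι K i)
        (FreeAlgebra.ι K j * FreeAlgebra.ι K i * FreeAlgebra.ι K j)
  | quad (i : Fin n) :
      HeckeRel q n (FreeAlgebra.ι K i * FreeAlgebra.ι K i)
        ((q - 1) • FreeAlgebra.ι K i + algebraMap K (FreeAlgebra K (Fin n)) q)

/-- The Hecke algebra `H_{n+1}(q)`: the unital associative `K`-algebra with generators
`T₁, …, Tₙ`, so `Hecke q 0` is `H₁(q) = K`. -/
abbrev Hecke (q : K) (n : ℕ) : Type _ := RingQuot (HeckeRel q n)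

/-- The generators of the Hecke algebra. -/
def T (q : K) {n : ℕ} (i : Fin n) : Hecke q n :=
  RingQuot.mkAlgHom K (HeckeRel q n) (FreeAlgebra.ι K i)

theorem T_far (q : K) {n : ℕ} (i j : Fin n) (h : (i : ℕ) + 2 ≤ (j : ℕ)) :
    T q i * T q j = T q j * T q i := by
  simpa only [T, map_mul] using RingQuot.mkAlgHom_rel K (HeckeRel.far (q := q) i j h)

theorem T_braid (q : K) {n : ℕ} (i j : Fin n) (h : (i : ℕ) + 1 = (j : ℕ)) :
    T q i * T q j * T q i = T q j * T q i * T q j := by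
  simpa only [T, map_mul] using RingQuot.mkAlgHom_rel K (HeckeRel.braid (q := q) i j h)

theorem T_quad (q : K) {n : ℕ} (i : Fin n) :
    T q i * T q i = (q - 1) • T q i + algebraMap K (Hecke q n) q := by
  simpa only [T, map_mul, map_add, map_smul, AlgHom.commutes] using
    RingQuot.mkAlgHom_rel K (HeckeRel.quad (q := q) i)

/-- The natural map `H_{n+1}(q) → H_{n+2}(q)` sending each generator to the generator with
the same subscript. -/
def incl (q : K) (n : ℕ) : Hecke q n →ₐ[K] Hecke q (n + 1) :=
  RingQuot.liftAlgHom K ⟨FreeAlgebra.lift K fun i => T q i.castSucc, by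
    intro x y h
    induction h with
    | far i j h => simpa using T_far q i.castSucc j.castSucc (by simpa using h)
    | braid i j h => simpa using T_braid q i.castSucc j.castSucc (by simpa using h)
    | quad i => simpa using T_quad q i.castSucc⟩

/-- `T_i` as a unit, with inverse `q⁻¹ (T_i + (1 - q))`. -/
def Tunit (q : K) (hq : q ≠ 0) {n : ℕ} (i : Fin n) : (Hecke q n)ˣ where
  val := T q i
  inv := q⁻¹ • (T q i + algebraMap K (Hecke q n) (1 - q))
  val_inv := by
    rw [mul_smul_comm, mul_add, T_quad, ← Algebra.commutes, ← Algebra.smul_def,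
      add_right_comm, ← add_smul]
    simp [Algebra.algebraMap_eq_smul_one, smul_smul, hq]
  inv_val := by
    rw [smul_mul_assoc, add_mul, T_quad, ← Algebra.smul_def,
      add_right_comm, ← add_smul]
    simp [Algebra.algebraMap_eq_smul_one, smul_smul, hq]

/-- The representation `ρ` of `B_{n+1}` in the units of `H_{n+1}(q)`, `σ_i ↦ T_i`. -/
def rho (q : K) (hq : q ≠ 0) (n : ℕ) : BraidGroup n →* (Hecke q n)ˣ :=
  PresentedGroup.toGroup (f := fun i => Tunit q hq i) (by
    intro w hw
    cases hw with
    | far i j h =>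
      simp only [map_mul, map_inv, FreeGroup.lift_apply_of, mul_inv_eq_one]
      exact Units.ext (T_far q i j h)
    | braid i j h =>
      simp only [map_mul, map_inv, FreeGroup.lift_apply_of, mul_inv_eq_one]
      exact Units.ext (T_braid q i j h))

/-- `Tr` is a family of `K`-linear trace functions `H_{i+1}(q) → K`, `i ≥ 0`, compatible with
the inclusions, normalized, and with the Markov property of parameter `z`
(an Ocneanu trace). -/
structure IsOcneanuTrace (q z : K) (Tr : ∀ i : ℕ, Hecke q i →ₗ[K] K) : Prop where
  compat : ∀ (i : ℕ) (a : Hecke q i), Tr (i + 1) (incl q i a) = Tr i a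
  one : ∀ i : ℕ, Tr i 1 = 1
  comm : ∀ (i : ℕ) (a b : Hecke q i), Tr i (a * b) = Tr i (b * a)
  markov : ∀ (i : ℕ) (a b : Hecke q i),
    Tr (i + 1) (incl q i a * T q (Fin.last i) * incl q i b) = z * Tr i (a * b)

end Hecke

/-- Laurent polynomials in two variables over `k`: the coefficient at `(a, b)` is that of the
monomial `q^a z^b`. -/
abbrev Laurent₂ (k : Type*) [Field k] : Type _ := AddMonoidAlgebra k (ℤ × ℤ)

/-- The value of a two-variable Laurent polynomial at `(q, z)`. -/
def Laurent₂.eval {k K : Type*} [Field k] [Field K] [Algebra k K] (P : Laurent₂ k)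
    (q z : K) : K :=
  ∑ e ∈ P.coeff.support, algebraMap k K (P.coeff e) * q ^ e.1 * z ^ e.2

/-- The set of total degrees of the monomials that occur in a Laurent polynomial. -/
def Laurent₂.degrees {k : Type*} [Field k] (P : Laurent₂ k) : Set ℤ :=
  {s | ∃ a b : ℤ, P.coeff (a, b) ≠ 0 ∧ a + b = s}

end WeavingTrace

end

/-!
The `q`- and `z`-degrees are best seen after the substitution `q = t`, `z = t w`, which makes the
total degree the degree in `t`. The trace of a positive word `a` of length `ℓ` with `s` distinct
letters is then a polynomial `Q ∈ k[w][t]`, and it is computed by three rules: braid moves change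
nothing, `T_i² = (t - 1) T_i + t`, and a top letter that occurs once contributes a factor `t w`
(`exists_braidEq_square_or_count_le_one` says that one of the last two rules always applies or
the top letter does not occur). These rules show by induction that `Q` has degree `ℓ` with
leading coefficient `w ^ s`, because for `t → ∞` the elements `T_i / t` become idempotent, and
that `t ^ s` divides `Q`; if no two letters are adjacent, the coefficient of `t ^ s` is a product
of factors `w` and `±(1 - w)`, one for each letter (`IsWordPoly`). The rules do not mention
a choice of trace, so the trace is unique.

The weaving braid is, up to the factor `q ^ (-m r)`, a product of generators `T_i` and of factors
`q T_i⁻¹ = T_i + (1 - q)`. In the top degree, the latter become `T_i - q`. The subsets of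
the `m` factors with the same `i` cancel against each other, up to
`(-1) ^ m (1 - w)`, so the leading coefficient is a product of factors `w` and `±(1 - w)`
(`signedPoly_top`). In the lowest degree only the summand `1` of `T_i + (1 - q)` contributes, since
`T_i` adds a letter and `-q` adds a degree (`dvd_signedPoly_sub_wordPoly`). What is left is a word
in pairwise commuting generators, whose lowest coefficient is known. All these coefficients
are non-zero over every field (`signedPoly_weavingWord`).

The existence of the trace is shown by writing down a conditional expectation
`E : H_{n+2}(q) → H_{n+1}(q)`. The elements `T_k T_{k+1} ⋯ T_n` should be a basis of `H_{n+2}(q)` as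
a right module over `H_{n+1}(q)`. The operators by which left multiplication with the generators
then acts on coordinates satisfy the Hecke relations (`cosetRep`), and
`E` is a linear form in the coordinates of `x * 1`; no basis theorem is needed. The map `E` is a
bimodule map with `E T_n = z`, and the trace property of `Tr ∘ E` follows from the
formula `E (T_n a T_n) = (q - 1) z a + q E' a`, where `E'` is the conditional expectation one level
below (`condExp_T_incl_T`).
-/

namespace WeavingTrace

/-! ### Words in the braid monoid -/

/-- `BraidEq u v` says that the positive word `u` turns into `v` by moves of the braid monoid:
exchanges of two letters that differ by at least `2`, and replacements of `(i+1) i (i+1)` by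
`i (i+1) i`. Only this direction of the second move is needed, so the relation is a preorder. -/
inductive BraidEq : List ℕ → List ℕ → Prop
  | refl (a : List ℕ) : BraidEq a a
  | far (a b : List ℕ) (i j : ℕ) (h : i + 2 ≤ j ∨ j + 2 ≤ i) :
      BraidEq (a ++ i :: j :: b) (a ++ j :: i :: b)
  | braid (a b : List ℕ) (i : ℕ) :
      BraidEq (a ++ (i + 1) :: i :: (i + 1) :: b) (a ++ i :: (i + 1) :: i :: b)
  | trans {a b c : List ℕ} : BraidEq a b → BraidEq b c → BraidEq a c

theorem BraidEq.context {u v : List ℕ} (h : BraidEq u v) (a b : List ℕ) :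
    BraidEq (a ++ u ++ b) (a ++ v ++ b) := by
  induction h with
  | refl => exact .refl _
  | far c d i j h => simpa using BraidEq.far (a ++ c) (d ++ b) i j h
  | braid c d i => simpa using BraidEq.braid (a ++ c) (d ++ b) i
  | trans _ _ h1 h2 => exact h1.trans h2

theorem BraidEq.length_eq {u v : List ℕ} (h : BraidEq u v) : u.length = v.length := by
  induction h with
  | refl => rfl
  | far | braid => simp
  | trans _ _ h1 h2 => exact h1.trans h2

theorem BraidEq.mem_iff {u v : List ℕ} (h : BraidEq u v) (x : ℕ) : x ∈ u ↔ x ∈ v := by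
  induction h with
  | refl => rfl
  | far | braid => simp only [List.mem_append, List.mem_cons]; tauto
  | trans _ _ h1 h2 => exact h1.trans h2

/-- Without adjacent letters only exchanges are possible, and these keep the multiplicities. -/
theorem BraidEq.count_eq {u v : List ℕ} (h : BraidEq u v) (hu : ∀ i ∈ u, i + 1 ∉ u) (x : ℕ) :
    u.count x = v.count x := by
  induction h with
  | refl => rfl
  | far => simp only [List.count_append, List.count_cons]; omega
  | braid a b i => exact absurd (by simp) (hu i (by simp))
  | trans h1' _ h1 h2 =>
    exact (h1 hu).trans (h2 fun i hi hi' =>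
      hu i ((h1'.mem_iff i).2 hi) ((h1'.mem_iff _).2 hi'))

theorem BraidEq.cons_append {x : List ℕ} {j : ℕ} (h : ∀ i ∈ x, i + 2 ≤ j) :
    BraidEq (j :: x) (x ++ [j]) := by
  induction x with
  | nil => exact .refl _
  | cons i x ih =>
    refine (BraidEq.far [] x j i (.inr (h i (by simp)))).trans ?_
    simpa using (ih fun k hk => h k (by simp [hk])).context [i] []

theorem BraidEq.append_cons {x : List ℕ} {j : ℕ} (h : ∀ i ∈ x, i + 2 ≤ j) :
    BraidEq (x ++ [j]) (j :: x) := by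
  induction x with
  | nil => exact .refl _
  | cons i x ih =>
    refine .trans ?_ (BraidEq.far [] x i j (.inl (h i (by simp))))
    simpa using (ih fun k hk => h k (by simp [hk])).context [i] []

theorem exists_two_of_count {n : ℕ} {w : List ℕ} (h : 2 ≤ w.count n) :
    ∃ a x b, w = a ++ n :: (x ++ n :: b) ∧ n ∉ x := by
  obtain ⟨a, w', rfl, ha⟩ :=
    List.eq_append_cons_of_mem (List.count_pos_iff.1 (by omega : 0 < w.count n))
  rw [List.count_append, List.count_eq_zero_of_not_mem ha, List.count_cons_self] at h
  obtain ⟨x, b, rfl, hx⟩ :=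
    List.eq_append_cons_of_mem (List.count_pos_iff.1 (by omega : 0 < w'.count n))
  exact ⟨a, x, b, rfl, hx⟩

/-- A positive word in the letters `0, …, n` can be moved so that it contains a square or
contains its top letter `n` at most once. Between two consecutive letters `n` the same statement
for `n - 1` applies, and leaves a word that commutes with `n` or permits the braid move
`n (n-1) n ↦ (n-1) n (n-1)`, which reduces the number of letters `n`. -/
theorem exists_braidEq_square_or_count_le_one (n : ℕ) : ∀ w : List ℕ, (∀ i ∈ w, i ≤ n) →
    ∃ w', BraidEq w w' ∧ ((∃ a i b, w' = a ++ i :: i :: b) ∨ w'.count n ≤ 1) := by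
  induction n with
  | zero =>
    intro w hw
    refine ⟨w, .refl _, ?_⟩
    by_cases h : 2 ≤ w.count 0
    · obtain ⟨a, x, b, rfl, hx⟩ := exists_two_of_count h
      cases x with
      | nil => exact .inl ⟨a, 0, b, rfl⟩
      | cons i x =>
        have := hw i (by simp)
        simp at hx
        omega
    · right; omega
  | succ n ih =>
    intro w
    induction hc : w.count (n + 1) using Nat.strong_induction_on generalizing w with
    | _ c ihc =>
    subst hc
    intro hw
    by_cases h : 2 ≤ w.count (n + 1)
    swap
    · exact ⟨w, .refl _, .inr (by omega)⟩
    obtain ⟨a, x, b, rfl, hx⟩ := exists_two_of_count h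
    have hxn : ∀ i ∈ x, i ≤ n := fun i hi => by
      have h1 := hw i (by simp [hi])
      have h2 : i ≠ n + 1 := fun h => hx (h ▸ hi)
      omega
    obtain ⟨x', hxx, hx'⟩ := ih x hxn
    have hx'n : ∀ i ∈ x', i ≤ n := fun i hi => hxn i ((hxx.mem_iff i).2 hi)
    have h1 : BraidEq (a ++ (n + 1) :: (x ++ (n + 1) :: b))
        (a ++ (n + 1) :: (x' ++ (n + 1) :: b)) := by
      simpa using hxx.context (a ++ [n + 1]) ((n + 1) :: b)
    obtain ⟨c, i, d, rfl⟩ | hx' := hx'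
    · exact ⟨_, h1, .inl ⟨a ++ (n + 1) :: c, i, d ++ (n + 1) :: b, by simp⟩⟩
    by_cases hmem : n ∈ x'
    swap
    · have hfar : ∀ i ∈ x', i + 2 ≤ n + 1 := fun i hi => by
        have h1 := hx'n i hi
        have h2 : i ≠ n := fun h => hmem (h ▸ hi)
        omega
      refine ⟨_, h1.trans ?_, .inl ⟨a ++ x', n + 1, b, rfl⟩⟩
      simpa using (BraidEq.cons_append hfar).context a ((n + 1) :: b)
    obtain ⟨c, d, rfl, hc⟩ := List.eq_append_cons_of_mem hmem
    have hd : n ∉ d := fun hd => by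
      have := List.count_pos_iff.2 hd
      simp at hx'
      omega
    have hcfar : ∀ i ∈ c, i + 2 ≤ n + 1 := fun i hi => by
      have h1 := hx'n i (by simp [hi])
      have h2 : i ≠ n := fun h => hc (h ▸ hi)
      omega
    have hdfar : ∀ i ∈ d, i + 2 ≤ n + 1 := fun i hi => by
      have h1 := hx'n i (by simp [hi])
      have h2 : i ≠ n := fun h => hd (h ▸ hi)
      omega
    -- Both outer letters `n + 1` move inwards next to the only letter `n` between them.
    have h2 : BraidEq (a ++ (n + 1) :: ((c ++ n :: d) ++ (n + 1) :: b))
        (a ++ c ++ n :: (n + 1) :: n :: (d ++ b)) := by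
      refine .trans ?_ (.braid _ _ _)
      refine .trans (b := a ++ c ++ (n + 1) :: n :: (d ++ (n + 1) :: b)) ?_ ?_
      · simpa using (BraidEq.cons_append hcfar).context a (n :: (d ++ (n + 1) :: b))
      · simpa using (BraidEq.append_cons hdfar).context (a ++ c ++ [n + 1, n]) b
    have h3 := h1.trans h2
    obtain ⟨w', hw', hw''⟩ := ihc _ (by
      have hc0 : c.count (n + 1) = 0 := List.count_eq_zero_of_not_mem fun h => by
        have := hcfar _ h; omega
      simp only [List.count_append, List.count_cons_self, hc0, List.count_cons_of_ne
        (show n ≠ n + 1 by omega)]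
      have hd0 : d.count (n + 1) = 0 := List.count_eq_zero_of_not_mem fun h => by
        have := hdfar _ h; omega
      omega) _ rfl (fun i hi => hw i ((h3.mem_iff i).2 hi))
    exact ⟨w', h3.trans hw', hw''⟩

/-! ### Words in the Hecke algebra -/

section Words

variable {K : Type*} [Field K] (q z : K)

/-- The generator of `H_{n+1}(q)` with index `i`, for any natural number `i`; the value `1` for
`n ≤ i` is a placeholder. -/
noncomputable def gen (n i : ℕ) : Hecke q n := if h : i < n then T q ⟨i, h⟩ else 1

theorem gen_of_lt {n i : ℕ} (h : i < n) : gen q n i = T q ⟨i, h⟩ := dif_pos h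

theorem T_eq_gen {n : ℕ} (i : Fin n) : T q i = gen q n i := by
  rw [gen_of_lt q i.isLt]

theorem gen_far {n i j : ℕ} (hi : i < n) (hj : j < n) (h : i + 2 ≤ j ∨ j + 2 ≤ i) :
    gen q n i * gen q n j = gen q n j * gen q n i := by
  rw [gen_of_lt q hi, gen_of_lt q hj]
  rcases h with h | h
  · exact T_far q _ _ h
  · exact (T_far q _ _ h).symm

theorem gen_braid {n i : ℕ} (hi : i + 1 < n) :
    gen q n i * gen q n (i + 1) * gen q n i = gen q n (i + 1) * gen q n i * gen q n (i + 1) := by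
  rw [gen_of_lt q hi, gen_of_lt q (by omega : i < n)]
  exact T_braid q _ _ rfl

theorem gen_quad {n i : ℕ} (hi : i < n) :
    gen q n i * gen q n i = (q - 1) • gen q n i + q • 1 := by
  rw [gen_of_lt q hi, T_quad, Algebra.algebraMap_eq_smul_one]

theorem incl_T {n : ℕ} (i : Fin n) : incl q n (T q i) = T q i.castSucc := by
  simp [incl, T]

theorem incl_gen {n i : ℕ} (hi : i < n) : incl q n (gen q n i) = gen q (n + 1) i := by
  rw [gen_of_lt q hi, incl_T, gen_of_lt q (by omega : i < n + 1)]
  rfl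

/-- The product of the generators of `H_{n+1}(q)` spelled by a word. -/
noncomputable def word (n : ℕ) (a : List ℕ) : Hecke q n := (a.map (gen q n)).prod

@[simp] theorem word_nil (n : ℕ) : word q n [] = 1 := rfl

@[simp] theorem word_cons (n i : ℕ) (a : List ℕ) : word q n (i :: a) = gen q n i * word q n a := by
  simp [word]

@[simp] theorem word_append (n : ℕ) (a b : List ℕ) :
    word q n (a ++ b) = word q n a * word q n b := by
  simp [word]

theorem incl_word {n : ℕ} {a : List ℕ} (ha : ∀ i ∈ a, i < n) :
    incl q n (word q n a) = word q (n + 1) a := by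
  induction a with
  | nil => simp
  | cons i a ih =>
    rw [word_cons, word_cons, map_mul, incl_gen q (ha i (by simp)),
      ih fun j hj => ha j (by simp [hj])]

theorem BraidEq.word_eq {n : ℕ} {u v : List ℕ} (h : BraidEq u v) (hu : ∀ i ∈ u, i < n) :
    word q n u = word q n v := by
  induction h with
  | refl => rfl
  | far a b i j h =>
    have := gen_far q (hu i (by simp)) (hu j (by simp)) h
    simp only [word_append, word_cons, ← mul_assoc]
    rw [mul_assoc (word q n a), this, ← mul_assoc]
  | braid a b i =>
    have := congrArg (word q n a * · * word q n b) (gen_braid q (hu (i + 1) (by simp)))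
    simpa only [word_append, word_cons, mul_assoc] using this.symm
  | trans h _ h1 h2 => exact (h1 hu).trans (h2 fun i hi => hu i ((h.mem_iff i).2 hi))

theorem word_square {n i : ℕ} (hi : i < n) (a b : List ℕ) :
    word q n (a ++ i :: i :: b) =
      (q - 1) • word q n (a ++ i :: b) + q • word q n (a ++ b) := by
  simp only [word_append, word_cons]
  rw [← mul_assoc (gen q n i), gen_quad q hi]
  simp only [add_mul, mul_add, smul_mul_assoc, mul_smul_comm, one_mul]

/-- The words in the generators span the Hecke algebra. -/
theorem word_induction {n : ℕ} {p : Hecke q n → Prop}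
    (hword : ∀ a : List ℕ, (∀ i ∈ a, i < n) → p (word q n a))
    (hadd : ∀ x y, p x → p y → p (x + y)) (hsmul : ∀ (c : K) x, p x → p (c • x))
    (x : Hecke q n) : p x := by
  let S : Set (Hecke q n) := {x | ∃ a : List ℕ, (∀ i ∈ a, i < n) ∧ x = word q n a}
  have hS : ∀ x y, x ∈ Submodule.span K S → y ∈ Submodule.span K S →
      x * y ∈ Submodule.span K S := by
    intro x y hx hy
    have := Submodule.mul_mem_mul hx hy
    rw [Submodule.span_mul_span] at this
    refine Submodule.span_mono ?_ this
    rintro _ ⟨_, ⟨a, ha, rfl⟩, _, ⟨b, hb, rfl⟩, rfl⟩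
    exact ⟨a ++ b, fun i hi => (List.mem_append.1 hi).elim (ha i) (hb i), (word_append ..).symm⟩
  have hmem : ∀ x : Hecke q n, x ∈ Submodule.span K S := by
    intro x
    obtain ⟨x, rfl⟩ := RingQuot.mkAlgHom_surjective K (HeckeRel q n) x
    induction x using FreeAlgebra.induction with
    | grade0 r =>
      rw [AlgHom.commutes, Algebra.algebraMap_eq_smul_one]
      exact Submodule.smul_mem _ _ (Submodule.subset_span ⟨[], by simp, rfl⟩)
    | grade1 i =>
      refine Submodule.subset_span ⟨[i], by simp, ?_⟩
      rw [word_cons, word_nil, mul_one, ← T_eq_gen]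
      rfl
    | mul a b ha hb => rw [map_mul]; exact hS _ _ ha hb
    | add a b ha hb => rw [map_add]; exact add_mem ha hb
  induction hmem x using Submodule.span_induction with
  | mem x h => obtain ⟨a, ha, rfl⟩ := h; exact hword a ha
  | zero => simpa using hsmul 0 _ (hword [] (by simp))
  | add x y _ _ hx hy => exact hadd x y hx hy
  | smul c x _ hx => exact hsmul c x hx

/-- `H_{n+2}(q)` is spanned by the natural image of `H_{n+1}(q)` and the elements `a Tₙ b`
with `a` and `b` in this image. -/
theorem hecke_succ_induction {n : ℕ} {p : Hecke q (n + 1) → Prop}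
    (hincl : ∀ a, p (incl q n a))
    (hmid : ∀ a b, p (incl q n a * T q (Fin.last n) * incl q n b))
    (hadd : ∀ x y, p x → p y → p (x + y)) (hsmul : ∀ (c : K) x, p x → p (c • x))
    (x : Hecke q (n + 1)) : p x := by
  refine word_induction q (fun a => ?_) hadd hsmul x
  induction hl : a.length using Nat.strong_induction_on generalizing a with
  | _ l ih =>
  subst hl
  intro ha
  obtain ⟨a', haa, ha'⟩ :=
    exists_braidEq_square_or_count_le_one n a fun i hi => Nat.lt_succ_iff.1 (ha i hi)
  rw [haa.word_eq q ha]
  have hlt : ∀ i ∈ a', i < n + 1 := fun i hi => ha i ((haa.mem_iff i).2 hi)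
  have hlen := haa.length_eq
  obtain ⟨b, i, c, rfl⟩ | ha' := ha'
  · rw [word_square q (hlt i (by simp))]
    simp only [List.length_append, List.length_cons] at hlen
    refine hadd _ _ (hsmul _ _ (ih _ ?_ _ rfl ?_)) (hsmul _ _ (ih _ ?_ _ rfl ?_))
    · simp; omega
    · intro j hj; apply hlt; simp at hj ⊢; tauto
    · simp; omega
    · intro j hj; apply hlt; simp at hj ⊢; tauto
  by_cases hmem : n ∈ a'
  · obtain ⟨b, c, rfl, hb⟩ := List.eq_append_cons_of_mem hmem
    have hc : n ∉ c := fun hc => by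
      have := List.count_pos_iff.2 hc
      simp at ha'
      omega
    have hb' : ∀ i ∈ b, i < n := fun i hi =>
      lt_of_le_of_ne (Nat.lt_succ_iff.1 (hlt i (by simp [hi]))) fun h => hb (h ▸ hi)
    have hc' : ∀ i ∈ c, i < n := fun i hi =>
      lt_of_le_of_ne (Nat.lt_succ_iff.1 (hlt i (by simp [hi]))) fun h => hc (h ▸ hi)
    rw [word_append, word_cons, ← incl_word q hb', ← incl_word q hc', ← mul_assoc]
    have := hmid (word q n b) (word q n c)
    rwa [T_eq_gen, Fin.val_last] at this
  · rw [← incl_word q (fun i hi =>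
      lt_of_le_of_ne (Nat.lt_succ_iff.1 (hlt i hi)) fun h => hmem (h ▸ hi))]
    exact hincl _

end Words

/-! ### The conditional expectation -/

section Action

variable {K : Type*} [Field K] (q z : K)

/-- Left multiplication by `T_j` on `H_{n+2}(q)` in coordinates. As a right module over
`H_{n+1}(q)`, the algebra `H_{n+2}(q)` is free on the elements `e_k = T_k T_{k+1} ⋯ T_n`,
`0 ≤ k ≤ n + 1`, where `e_{n+1} = 1`; the function `v` stands for `∑ k, e_k * v k`. -/
noncomputable def cosetOp (n : ℕ) (j : Fin (n + 1)) :
    (Fin (n + 2) → Hecke q n) →ₗ[K] (Fin (n + 2) → Hecke q n) where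
  toFun v k :=
    if (k : ℕ) < j then gen q n (j - 1) * v k
    else if (k : ℕ) = j then v j.succ + (q - 1) • v k
    else if (k : ℕ) = j + 1 then q • v j.castSucc
    else gen q n j * v k
  map_add' v w := by
    funext k
    simp only [Pi.add_apply]
    split_ifs <;> simp only [mul_add, smul_add, add_add_add_comm]
  map_smul' c v := by
    funext k
    simp only [Pi.smul_apply, RingHom.id_apply]
    split_ifs <;> simp only [mul_smul_comm, smul_add, smul_comm c]

variable {q} in
theorem cosetOp_lt {n : ℕ} {j : Fin (n + 1)} {v : Fin (n + 2) → Hecke q n} {k : Fin (n + 2)}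
    (h : (k : ℕ) < j) : cosetOp q n j v k = gen q n (j - 1) * v k := if_pos h

variable {q} in
theorem cosetOp_eq {n : ℕ} {j : Fin (n + 1)} {v : Fin (n + 2) → Hecke q n} {k l : Fin (n + 2)}
    (h : (k : ℕ) = j) (hl : (l : ℕ) = j + 1) :
    cosetOp q n j v k = v l + (q - 1) • v k := by
  have : l = j.succ := Fin.ext hl
  subst this
  exact (if_neg (by omega)).trans (if_pos h)

variable {q} in
theorem cosetOp_succ {n : ℕ} {j : Fin (n + 1)} {v : Fin (n + 2) → Hecke q n} {k l : Fin (n + 2)}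
    (h : (k : ℕ) = j + 1) (hl : (l : ℕ) = j) : cosetOp q n j v k = q • v l := by
  have : l = j.castSucc := Fin.ext hl
  subst this
  exact (if_neg (by omega)).trans ((if_neg (by omega)).trans (if_pos h))

variable {q} in
theorem cosetOp_gt {n : ℕ} {j : Fin (n + 1)} {v : Fin (n + 2) → Hecke q n} {k : Fin (n + 2)}
    (h : (j : ℕ) + 1 < k) : cosetOp q n j v k = gen q n j * v k :=
  (if_neg (by omega)).trans ((if_neg (by omega)).trans (if_neg (by omega)))

theorem cosetOp_quad (n : ℕ) (j : Fin (n + 1)) :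
    cosetOp q n j * cosetOp q n j = (q - 1) • cosetOp q n j + q • 1 := by
  refine LinearMap.ext fun v => funext fun k => ?_
  simp only [Module.End.mul_apply, LinearMap.add_apply, LinearMap.smul_apply, Module.End.one_apply,
    Pi.add_apply, Pi.smul_apply]
  have hj := j.isLt
  have hk := k.isLt
  have e0 : ((j.castSucc : Fin (n + 2)) : ℕ) = j := rfl
  have e1 : ((j.succ : Fin (n + 2)) : ℕ) = j + 1 := rfl
  generalize j.castSucc = k0 at e0
  generalize j.succ = k1 at e1
  have j0 (v) : cosetOp q n j v k0 = v k1 + (q - 1) • v k0 := cosetOp_eq e0 e1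
  have j1 (v) : cosetOp q n j v k1 = q • v k0 := cosetOp_succ e1 e0
  obtain h1 | h1 | h1 | h1 : (k : ℕ) < j ∨ k = k0 ∨ k = k1 ∨ (j : ℕ) + 1 < k := by
    simp only [Fin.ext_iff]; omega
  · simp only [cosetOp_lt h1]
    rw [← mul_assoc, gen_quad q (by omega), add_mul, smul_mul_assoc, smul_mul_assoc, one_mul]
  · subst h1
    simp only [j0, j1]
    module
  · subst h1
    simp only [j0, j1]
    module
  · simp only [cosetOp_gt h1]
    rw [← mul_assoc, gen_quad q (by omega), add_mul, smul_mul_assoc, smul_mul_assoc, one_mul]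

theorem cosetOp_far {n : ℕ} {i j : Fin (n + 1)} (h : (i : ℕ) + 2 ≤ j) :
    cosetOp q n i * cosetOp q n j = cosetOp q n j * cosetOp q n i := by
  refine LinearMap.ext fun v => funext fun k => ?_
  simp only [Module.End.mul_apply]
  have hj := j.isLt
  have hk := k.isLt
  obtain h1 | h1 | h1 | h1 | h1 | h1 | h1 : (k : ℕ) < i ∨ (k : ℕ) = i ∨ (k : ℕ) = i + 1 ∨
    ((i : ℕ) + 1 < k ∧ (k : ℕ) < j) ∨ (k : ℕ) = j ∨ (k : ℕ) = j + 1 ∨ (j : ℕ) + 1 < k := by omega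
  · rw [cosetOp_lt h1, cosetOp_lt (by omega), cosetOp_lt (by omega), cosetOp_lt h1,
      ← mul_assoc, ← mul_assoc, gen_far q (by omega) (by omega) (by omega)]
  · have hl : ((i.succ : Fin (n + 2)) : ℕ) = i + 1 := rfl
    rw [cosetOp_eq h1 hl, cosetOp_lt (by omega), cosetOp_lt (by omega), cosetOp_lt (by omega),
      cosetOp_eq h1 hl, mul_add, mul_smul_comm]
  · have hl : ((i.castSucc : Fin (n + 2)) : ℕ) = i := rfl
    rw [cosetOp_succ h1 hl, cosetOp_lt (by omega), cosetOp_lt (by omega),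
      cosetOp_succ h1 hl, mul_smul_comm]
  · rw [cosetOp_gt h1.1, cosetOp_lt h1.2, cosetOp_lt h1.2, cosetOp_gt h1.1,
      ← mul_assoc, ← mul_assoc, gen_far q (by omega) (by omega) (by omega)]
  · have hl : ((j.succ : Fin (n + 2)) : ℕ) = j + 1 := rfl
    rw [cosetOp_gt (by omega), cosetOp_eq h1 hl, cosetOp_eq h1 hl, cosetOp_gt (by omega),
      cosetOp_gt (by omega), mul_add, mul_smul_comm]
  · have hl : ((j.castSucc : Fin (n + 2)) : ℕ) = j := rfl
    rw [cosetOp_gt (by omega), cosetOp_succ h1 hl, cosetOp_succ h1 hl, cosetOp_gt (by omega),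
      mul_smul_comm]
  · rw [cosetOp_gt (by omega), cosetOp_gt h1, cosetOp_gt h1, cosetOp_gt (by omega),
      ← mul_assoc, ← mul_assoc, gen_far q (by omega) (by omega) (by omega)]

theorem cosetOp_braid {n : ℕ} {i j : Fin (n + 1)} (h : (i : ℕ) + 1 = j) :
    cosetOp q n i * cosetOp q n j * cosetOp q n i =
      cosetOp q n j * cosetOp q n i * cosetOp q n j := by
  refine LinearMap.ext fun v => funext fun k => ?_
  simp only [Module.End.mul_apply]
  have hj := j.isLt
  have hk := k.isLt
  have e0 : ((i.castSucc : Fin (n + 2)) : ℕ) = i := rfl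
  have e1 : ((j.castSucc : Fin (n + 2)) : ℕ) = i + 1 := h.symm
  have e2 : ((j.succ : Fin (n + 2)) : ℕ) = i + 2 := by simp; omega
  generalize i.castSucc = k0 at e0
  generalize j.castSucc = k1 at e1
  generalize j.succ = k2 at e2
  have i0 (v) : cosetOp q n i v k0 = v k1 + (q - 1) • v k0 := cosetOp_eq e0 e1
  have i1 (v) : cosetOp q n i v k1 = q • v k0 := cosetOp_succ e1 e0
  have i2 (v) : cosetOp q n i v k2 = gen q n i * v k2 := cosetOp_gt (by omega)
  have j0 (v) : cosetOp q n j v k0 = gen q n i * v k0 := by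
    rw [cosetOp_lt (by omega), ← h]; rfl
  have j1 (v) : cosetOp q n j v k1 = v k2 + (q - 1) • v k1 :=
    cosetOp_eq (by omega) (by omega)
  have j2 (v) : cosetOp q n j v k2 = q • v k1 := cosetOp_succ (by omega) (by omega)
  obtain h1 | h1 | h1 | h1 | h1 : (k : ℕ) < i ∨ k = k0 ∨ k = k1 ∨ k = k2 ∨ (j : ℕ) + 1 < k := by
    simp only [Fin.ext_iff]; omega
  · have hb := gen_braid q (n := n) (i := i - 1) (by omega)
    rw [show (i : ℕ) - 1 + 1 = i by omega] at hb
    simp only [cosetOp_lt h1, cosetOp_lt (show (k : ℕ) < j by omega), ← mul_assoc]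
    rw [show (j : ℕ) - 1 = i by omega, hb]
  · subst h1
    have hg : gen q n i * (gen q n i * v k) = (q - 1) • (gen q n i * v k) + q • v k := by
      rw [← mul_assoc, gen_quad q (by omega), add_mul, smul_mul_assoc, smul_mul_assoc, one_mul]
    simp only [i0, i1, i2, j0, j1, mul_add, mul_smul_comm, hg]
    module
  · subst h1
    simp only [i0, i1, i2, j0, j1, j2, mul_add, mul_smul_comm]
    module
  · subst h1
    simp only [i1, i2, j0, j2, mul_smul_comm]
  · have hb := gen_braid q (n := n) (i := i) (by omega)
    simp only [cosetOp_gt h1, cosetOp_gt (show (i : ℕ) + 1 < k by omega), ← mul_assoc]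
    rw [← h, hb]

/-- The left regular representation of `H_{n+2}(q)`, with coordinates in `H_{n+1}(q)`. -/
noncomputable def cosetRep (n : ℕ) :
    Hecke q (n + 1) →ₐ[K] Module.End K (Fin (n + 2) → Hecke q n) :=
  RingQuot.liftAlgHom K ⟨FreeAlgebra.lift K (cosetOp q n), by
    intro x y h
    induction h with
    | far i j h => simpa using cosetOp_far q h
    | braid i j h => simpa using cosetOp_braid q h
    | quad i => simpa [Algebra.algebraMap_eq_smul_one] using cosetOp_quad q n i⟩

theorem cosetRep_T {n : ℕ} (j : Fin (n + 1)) : cosetRep q n (T q j) = cosetOp q n j := by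
  simp [cosetRep, T]

/-- The representation commutes with right multiplication by `H_{n+1}(q)`. -/
theorem cosetRep_mul_right {n : ℕ} (x : Hecke q (n + 1)) (v : Fin (n + 2) → Hecke q n)
    (b : Hecke q n) : cosetRep q n x (fun k => v k * b) = fun k => cosetRep q n x v k * b := by
  induction x using word_induction generalizing v with
  | hword a ha =>
    induction a generalizing v with
    | nil => simp
    | cons j a ih =>
      have hj := ha j (by simp)
      rw [word_cons, map_mul, Module.End.mul_apply, Module.End.mul_apply,
        ih (fun i hi => ha i (by simp [hi])), gen_of_lt q hj, cosetRep_T]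
      funext k
      simp only [cosetOp, LinearMap.coe_mk, AddHom.coe_mk]
      split_ifs <;> simp only [mul_assoc, add_mul, smul_mul_assoc]
  | hadd x y hx hy =>
    simp only [map_add, LinearMap.add_apply, hx, hy]
    funext k
    simp only [Pi.add_apply, add_mul]
  | hsmul c x hx =>
    simp only [map_smul, LinearMap.smul_apply, hx]
    funext k
    simp only [Pi.smul_apply, smul_mul_assoc]

/-- `H_{n+1}(q)` acts on the coordinate of `e_{n+1} = 1` by left multiplication. -/
theorem cosetRep_incl_single {n : ℕ} (a b : Hecke q n) :
    cosetRep q n (incl q n a) (Pi.single (Fin.last (n + 1)) b) =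
      Pi.single (Fin.last (n + 1)) (a * b) := by
  induction a using word_induction with
  | hword a ha =>
    induction a with
    | nil => simp
    | cons j a ih =>
      have hj := ha j (by simp)
      rw [word_cons, map_mul, map_mul, Module.End.mul_apply,
        ih (fun i hi => ha i (by simp [hi])), gen_of_lt q hj, incl_T, cosetRep_T]
      have hlast : ((Fin.last (n + 1) : Fin (n + 2)) : ℕ) = n + 1 := rfl
      have hcast : (((⟨j, hj⟩ : Fin n).castSucc : Fin (n + 1)) : ℕ) = j := rfl
      funext k
      by_cases hk : k = Fin.last (n + 1)
      · subst hk
        rw [cosetOp_gt (by omega), Pi.single_eq_same, Pi.single_eq_same, hcast, gen_of_lt q hj,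
          mul_assoc]
      · rw [Pi.single_eq_of_ne hk]
        have hne : ∀ l : Fin (n + 2), (l : ℕ) ≤ n →
            Pi.single (M := fun _ => Hecke q n) (Fin.last (n + 1))
              (word q n a * b) l = 0 := fun l hl =>
          Pi.single_eq_of_ne (fun h => by subst h; omega) _
        have hk' : (k : ℕ) ≤ n := by
          have := Fin.val_lt_last hk
          omega
        simp only [cosetOp, LinearMap.coe_mk, AddHom.coe_mk, hne k hk',
          hne (⟨j, hj⟩ : Fin n).castSucc.succ (by simp; omega),
          hne (⟨j, hj⟩ : Fin n).castSucc.castSucc (by simp; omega)]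
        simp
  | hadd x y hx hy =>
    simp only [map_add, LinearMap.add_apply, hx, hy, add_mul, Pi.single_add]
  | hsmul c x hx =>
    simp only [map_smul, LinearMap.smul_apply, hx, smul_mul_assoc, Pi.single_smul]

/-- The product `T_k T_{k+1} ⋯ T_{n-1}` in `H_{n+1}(q)`, which is `1` for `k = n`. -/
noncomputable def ascending (n k : ℕ) : Hecke q n := word q n (List.range' k (n - k))

theorem ascending_self (n : ℕ) : ascending q n n = 1 := by simp [ascending]

theorem ascending_of_lt {n k : ℕ} (h : k < n) :
    ascending q n k = gen q n k * ascending q n (k + 1) := by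
  rw [ascending, show n - k = (n - (k + 1)) + 1 by omega, List.range'_succ, word_cons, ascending]

theorem gen_mul_ascending_of_gt {n j k : ℕ} (hj : j + 1 < k) (hk : k ≤ n) :
    gen q n j * ascending q n k = ascending q n k * gen q n j := by
  induction hk using Nat.decreasingInduction with
  | self => simp [ascending_self]
  | of_succ k hk ih =>
    rw [ascending_of_lt q hk, ← mul_assoc, gen_far q (by omega) hk (by omega), mul_assoc,
      ih (by omega), mul_assoc]

theorem gen_mul_ascending_of_lt {n j k : ℕ} (hk : k < j) (hj : j < n) :
    gen q n j * ascending q n k = ascending q n k * gen q n (j - 1) := by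
  have hkj : k ≤ j - 1 := by omega
  induction hkj using Nat.decreasingInduction with
  | self =>
    obtain ⟨i, rfl⟩ : ∃ i, j = i + 1 := ⟨j - 1, by omega⟩
    rw [Nat.add_sub_cancel, ascending_of_lt q (by omega), ascending_of_lt q hj]
    simp only [← mul_assoc]
    rw [← gen_braid q hj, mul_assoc (gen q n i * gen q n (i + 1)),
      gen_mul_ascending_of_gt q (by omega) (by omega), mul_assoc (gen q n i * gen q n (i + 1))]
  | of_succ k hkj ih =>
    rw [ascending_of_lt q (by omega), ← mul_assoc, gen_far q hj (by omega) (by omega), mul_assoc,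
      ih (by omega), mul_assoc]

/-- The weights of the conditional expectation: `H_{n+2}(q) → H_{n+1}(q)` sends `e_{n+1} = 1` to
`1` and `e_k = T_k ⋯ T_n` to `z T_k ⋯ T_{n-1}` for `k ≤ n`. -/
noncomputable def weight (n k : ℕ) : Hecke q n := if k ≤ n then z • ascending q n k else 1

theorem weight_of_le {n k : ℕ} (h : k ≤ n) : weight q z n k = z • ascending q n k := if_pos h

theorem weight_of_gt {n k : ℕ} (h : n < k) : weight q z n k = 1 := if_neg (by omega)

/-- The linear form on the coset coordinates with coefficients `weight`. -/
noncomputable def weightForm (n : ℕ) : (Fin (n + 2) → Hecke q n) →ₗ[K] Hecke q n where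
  toFun v := ∑ k : Fin (n + 2), weight q z n k * v k
  map_add' v w := by simp [mul_add, Finset.sum_add_distrib]
  map_smul' c v := by simp [Finset.smul_sum]

theorem weightForm_single {n : ℕ} (k : Fin (n + 2)) (b : Hecke q n) :
    weightForm q z n (Pi.single k b) = weight q z n k * b := by
  simp only [weightForm, LinearMap.coe_mk, AddHom.coe_mk]
  rw [Finset.sum_eq_single k, Pi.single_eq_same]
  · intro l _ hl
    rw [Pi.single_eq_of_ne hl, mul_zero]
  · simp

theorem weightForm_cosetOp {n : ℕ} (j : Fin n) (v : Fin (n + 2) → Hecke q n) :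
    weightForm q z n (cosetOp q n j.castSucc v) = gen q n j * weightForm q z n v := by
  have hj := j.isLt
  have e0 : ((j.castSucc.castSucc : Fin (n + 2)) : ℕ) = j := rfl
  have e1 : ((j.castSucc.succ : Fin (n + 2)) : ℕ) = j + 1 := rfl
  have ej : (j.castSucc : ℕ) = j := rfl
  generalize j.castSucc.castSucc = k0 at e0
  generalize j.castSucc.succ = k1 at e1
  have hne : k0 ≠ k1 := fun h => by subst h; omega
  have hne' : ∀ k, k ∈ (Finset.univ.erase k0).erase k1 → (k : ℕ) ≠ j ∧ (k : ℕ) ≠ j + 1 := by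
    intro k hk
    simp only [Finset.mem_erase, ne_eq, Fin.ext_iff] at hk
    omega
  -- Only the coordinates `j` and `j + 1` are mixed; the other summands agree one by one.
  simp only [weightForm, LinearMap.coe_mk, AddHom.coe_mk, Finset.mul_sum]
  rw [← Finset.add_sum_erase _ _ (Finset.mem_univ k0),
    ← Finset.add_sum_erase _ _ (Finset.mem_erase.2 ⟨hne.symm, Finset.mem_univ k1⟩),
    ← Finset.add_sum_erase Finset.univ (fun k : Fin (n + 2) => gen q n j * (weight q z n k * v k))
      (Finset.mem_univ k0),
    ← Finset.add_sum_erase (Finset.univ.erase k0)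
      (fun k : Fin (n + 2) => gen q n j * (weight q z n k * v k))
      (Finset.mem_erase.2 ⟨hne.symm, Finset.mem_univ k1⟩), ← add_assoc, ← add_assoc]
  congr 1
  · have hq : gen q n j * (gen q n j * weight q z n (j + 1)) =
        (q - 1) • (gen q n j * weight q z n (j + 1)) + q • weight q z n (j + 1) := by
      rw [← mul_assoc, gen_quad q hj, add_mul, smul_mul_assoc, smul_mul_assoc, one_mul]
    have hw : weight q z n j = gen q n j * weight q z n (j + 1) := by
      rw [weight_of_le q z (by omega), weight_of_le q z (by omega), ascending_of_lt q hj,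
        mul_smul_comm]
    rw [cosetOp_eq (e0.trans ej.symm) e1, cosetOp_succ e1 (e0.trans ej.symm), e0, e1,
      ← mul_assoc, ← mul_assoc, hw, hq]
    simp only [mul_add, add_mul, smul_mul_assoc, mul_smul_comm]
    abel
  · refine Finset.sum_congr rfl fun k hk => ?_
    obtain ⟨h1, h2⟩ := hne' k hk
    have hkn := k.isLt
    rw [← mul_assoc]
    obtain h | h : (k : ℕ) < j ∨ (j : ℕ) + 1 < k := by omega
    · rw [cosetOp_lt (by omega), ← mul_assoc, weight_of_le q z (by omega), mul_smul_comm,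
        gen_mul_ascending_of_lt q h hj, ej, smul_mul_assoc]
    · rw [cosetOp_gt (by omega), ← mul_assoc, ej]
      by_cases hk' : (k : ℕ) ≤ n
      · rw [weight_of_le q z hk', mul_smul_comm, gen_mul_ascending_of_gt q h hk', smul_mul_assoc]
      · rw [weight_of_gt q z (by omega), one_mul, mul_one]

theorem weightForm_incl {n : ℕ} (a : Hecke q n) (v : Fin (n + 2) → Hecke q n) :
    weightForm q z n (cosetRep q n (incl q n a) v) = a * weightForm q z n v := by
  induction a using word_induction with
  | hword a ha =>
    induction a generalizing v with
    | nil => simp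
    | cons j a ih =>
      have hj := ha j (by simp)
      rw [word_cons, map_mul, map_mul, Module.End.mul_apply, gen_of_lt q hj, incl_T, cosetRep_T,
        weightForm_cosetOp, ih _ (fun i hi => ha i (by simp [hi])), T_eq_gen, mul_assoc]
  | hadd x y hx hy => simp only [map_add, LinearMap.add_apply, hx, hy, add_mul]
  | hsmul c x hx => simp only [map_smul, LinearMap.smul_apply, hx, smul_mul_assoc]

/-- The conditional expectation `H_{n+2}(q) → H_{n+1}(q)`, the `H_{n+1}(q)`-bimodule map with
`1 ↦ 1` and `T_n ↦ z`. -/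
noncomputable def condExp (n : ℕ) : Hecke q (n + 1) →ₗ[K] Hecke q n where
  toFun x := weightForm q z n (cosetRep q n x (Pi.single (Fin.last (n + 1)) 1))
  map_add' x y := by simp only [map_add, LinearMap.add_apply]
  map_smul' c x := by simp only [map_smul, LinearMap.smul_apply, RingHom.id_apply]

theorem condExp_incl_mul {n : ℕ} (a : Hecke q n) (x : Hecke q (n + 1)) :
    condExp q z n (incl q n a * x) = a * condExp q z n x := by
  simp only [condExp, LinearMap.coe_mk, AddHom.coe_mk, map_mul, Module.End.mul_apply,
    weightForm_incl]

theorem condExp_mul_incl {n : ℕ} (x : Hecke q (n + 1)) (b : Hecke q n) :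
    condExp q z n (x * incl q n b) = condExp q z n x * b := by
  have h : (Pi.single (Fin.last (n + 1)) b : Fin (n + 2) → Hecke q n) =
      fun k => (Pi.single (Fin.last (n + 1)) 1 : Fin (n + 2) → Hecke q n) k * b := by
    funext k
    by_cases hk : k = Fin.last (n + 1)
    · subst hk; simp
    · simp [Pi.single_eq_of_ne hk]
  simp only [condExp, LinearMap.coe_mk, AddHom.coe_mk, map_mul, Module.End.mul_apply]
  rw [cosetRep_incl_single, mul_one, h, cosetRep_mul_right]
  simp only [weightForm, LinearMap.coe_mk, AddHom.coe_mk, Finset.sum_mul, mul_assoc]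

theorem condExp_one (n : ℕ) : condExp q z n 1 = 1 := by
  simp only [condExp, LinearMap.coe_mk, AddHom.coe_mk, map_one, Module.End.one_apply]
  rw [weightForm_single, weight_of_gt q z (by simp), mul_one]

theorem condExp_incl {n : ℕ} (a : Hecke q n) : condExp q z n (incl q n a) = a := by
  simpa [condExp_one] using condExp_incl_mul q z a 1

theorem condExp_T (n : ℕ) : condExp q z n (T q (Fin.last n)) = z • 1 := by
  have hlast : ((Fin.last (n + 1) : Fin (n + 2)) : ℕ) = n + 1 := rfl
  have hn : ((Fin.last n : Fin (n + 1)) : ℕ) = n := rfl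
  have h : cosetOp q n (Fin.last n) (Pi.single (Fin.last (n + 1)) 1) =
      Pi.single (Fin.last n).castSucc 1 := by
    have hcast : (((Fin.last n).castSucc : Fin (n + 2)) : ℕ) = n := rfl
    have hne : (Fin.last n).castSucc ≠ Fin.last (n + 1) := fun h => by
      rw [Fin.ext_iff] at h; omega
    funext k
    have hk := k.isLt
    obtain h1 | h1 | h1 : (k : ℕ) < n ∨ k = (Fin.last n).castSucc ∨ k = Fin.last (n + 1) := by
      simp only [Fin.ext_iff]; omega
    · rw [cosetOp_lt (by omega), Pi.single_eq_of_ne (fun h => by subst h; omega), mul_zero,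
        Pi.single_eq_of_ne (fun h => by subst h; omega)]
    · subst h1
      rw [cosetOp_eq (l := Fin.last (n + 1)) (by omega) (by omega), Pi.single_eq_same,
        Pi.single_eq_of_ne hne, smul_zero, add_zero, Pi.single_eq_same]
    · subst h1
      rw [cosetOp_succ (l := (Fin.last n).castSucc) (by omega) (by omega),
        Pi.single_eq_of_ne hne, smul_zero, Pi.single_eq_of_ne hne.symm]
  simp only [condExp, LinearMap.coe_mk, AddHom.coe_mk, cosetRep_T, h]
  rw [weightForm_single, weight_of_le q z (by simp), Fin.val_castSucc, Fin.val_last,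
    ascending_self, mul_one]

end Action

/-! ### Existence of the Ocneanu trace -/

section Trace

variable {K : Type*} [Field K] (q z : K)

theorem mul_comm_zero (a b : Hecke q 0) : a * b = b * a := by
  induction a using word_induction with
  | hword a ha =>
    cases a with
    | nil => simp
    | cons i a => exact absurd (ha i (by simp)) (by omega)
  | hadd x y hx hy => rw [add_mul, mul_add, hx, hy]
  | hsmul c x hx => rw [smul_mul_assoc, mul_smul_comm, hx]

/-- The Ocneanu trace, obtained by iterating the conditional expectations down to
`H_1(q) = K`. -/
noncomputable def ocneanu : ∀ i : ℕ, Hecke q i →ₗ[K] K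
  | 0 => (RingQuot.liftAlgHom K ⟨FreeAlgebra.lift K fun i : Fin 0 => i.elim0, by
      intro x y h
      induction h with
      | far i | braid i | quad i => exact i.elim0⟩ : Hecke q 0 →ₐ[K] K).toLinearMap
  | i + 1 => ocneanu i ∘ₗ condExp q z i

theorem ocneanu_zero_one : ocneanu q z 0 1 = 1 := by
  simp [ocneanu]

theorem ocneanu_succ (n : ℕ) (x : Hecke q (n + 1)) :
    ocneanu q z (n + 1) x = ocneanu q z n (condExp q z n x) := rfl

theorem T_last_mul_T_last (n : ℕ) :
    T q (Fin.last n) * T q (Fin.last n) = (q - 1) • T q (Fin.last n) + q • 1 := by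
  rw [T_quad, Algebra.algebraMap_eq_smul_one]

theorem condExp_T_mul_T (n : ℕ) :
    condExp q z n (T q (Fin.last n) * T q (Fin.last n)) = ((q - 1) * z + q) • 1 := by
  rw [T_last_mul_T_last, map_add, map_smul, map_smul, condExp_T, condExp_one, smul_smul, add_smul]

theorem T_last_comm_incl_incl (n : ℕ) (u : Hecke q n) :
    T q (Fin.last (n + 1)) * incl q (n + 1) (incl q n u) =
      incl q (n + 1) (incl q n u) * T q (Fin.last (n + 1)) := by
  induction u using word_induction with
  | hword a ha =>
    induction a with
    | nil => simp
    | cons i a ih =>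
      have hi := ha i (by simp)
      rw [word_cons, map_mul, map_mul, incl_gen q hi, incl_gen q (by omega), ← mul_assoc,
        T_eq_gen, gen_far q (by simp) (by omega) (.inr (by simp; omega)), mul_assoc, ← T_eq_gen,
        ih fun j hj => ha j (by simp [hj]), mul_assoc]
  | hadd x y hx hy => simp only [map_add, mul_add, add_mul, hx, hy]
  | hsmul c x hx => simp only [map_smul, mul_smul_comm, smul_mul_assoc, hx]

theorem T_last_braid (n : ℕ) :
    T q (Fin.last (n + 1)) * incl q (n + 1) (T q (Fin.last n)) * T q (Fin.last (n + 1)) =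
      incl q (n + 1) (T q (Fin.last n)) * T q (Fin.last (n + 1)) *
        incl q (n + 1) (T q (Fin.last n)) := by
  rw [incl_T]
  exact (T_braid q _ _ rfl).symm

/-- This formula is symmetric enough to give the trace property: it turns
`Tr (a T_{n+1} b T_{n+1}) = Tr (T_{n+1} a T_{n+1} b)` into the symmetry of `Tr (a b)` and of
`Tr (E a * E b)`, where `E` is the conditional expectation one level below. -/
theorem condExp_T_incl_T (n : ℕ) (a : Hecke q (n + 1)) :
    condExp q z (n + 1) (T q (Fin.last (n + 1)) * incl q (n + 1) a * T q (Fin.last (n + 1))) =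
      ((q - 1) * z) • a + q • incl q n (condExp q z n a) := by
  induction a using hecke_succ_induction with
  | hincl u =>
    rw [T_last_comm_incl_incl, mul_assoc, condExp_incl_mul, condExp_T_mul_T, condExp_incl,
      mul_smul_comm, mul_one, add_smul]
  | hmid u v =>
    have h : T q (Fin.last (n + 1)) * incl q (n + 1) (incl q n u * T q (Fin.last n) * incl q n v) *
        T q (Fin.last (n + 1)) = incl q (n + 1) (incl q n u * T q (Fin.last n)) *
          T q (Fin.last (n + 1)) * incl q (n + 1) (T q (Fin.last n) * incl q n v) := by
      simp only [map_mul]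
      have hu := T_last_comm_incl_incl q n u
      have hv := T_last_comm_incl_incl q n v
      have hs := T_last_braid q n
      generalize T q (Fin.last (n + 1)) = t at *
      generalize incl q (n + 1) (incl q n u) = u at *
      generalize incl q (n + 1) (incl q n v) = v at *
      generalize incl q (n + 1) (T q (Fin.last n)) = s at *
      calc t * (u * s * v) * t = t * u * s * (v * t) := by simp only [mul_assoc]
        _ = u * (t * s * t) * v := by rw [← hv, hu]; simp only [mul_assoc]
        _ = u * s * t * (s * v) := by rw [hs]; simp only [mul_assoc]
    rw [h, condExp_mul_incl, condExp_incl_mul, condExp_T, condExp_mul_incl, condExp_incl_mul,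
      condExp_T, mul_smul_comm, mul_one, smul_mul_assoc, mul_assoc,
      ← mul_assoc (T q (Fin.last n)), T_last_mul_T_last]
    simp only [mul_smul_comm, smul_mul_assoc, map_smul, map_mul, add_mul, mul_add, mul_one,
      one_mul, mul_assoc]
    module
  | hadd x y hx hy =>
    simp only [map_add, mul_add, add_mul, hx, hy]
    module
  | hsmul c x hx =>
    simp only [map_smul, mul_smul_comm, smul_mul_assoc, hx]
    module

theorem ocneanu_comm (n : ℕ) (x y : Hecke q n) :
    ocneanu q z n (x * y) = ocneanu q z n (y * x) := by
  induction n with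
  | zero => rw [mul_comm_zero]
  | succ n ih =>
    have hincl : ∀ (a : Hecke q n) x, ocneanu q z (n + 1) (x * incl q n a) =
        ocneanu q z (n + 1) (incl q n a * x) := by
      intro a x
      rw [ocneanu_succ, ocneanu_succ, condExp_mul_incl, condExp_incl_mul, ih]
    have hE : ∀ a b : Hecke q n, ocneanu q z n (a * condExp q z n (T q (Fin.last n) *
        incl q n b * T q (Fin.last n))) = ocneanu q z n (condExp q z n (T q (Fin.last n) *
        incl q n a * T q (Fin.last n)) * b) := by
      intro a b
      cases n with
      | zero =>
        have h : ∀ c : Hecke q 0, condExp q z 0 (T q (Fin.last 0) * incl q 0 c * T q (Fin.last 0)) =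
            ((q - 1) * z + q) • c := by
          intro c
          have hc : T q (Fin.last 0) * incl q 0 c = incl q 0 c * T q (Fin.last 0) := by
            induction c using word_induction with
            | hword a ha =>
              cases a with
              | nil => simp
              | cons i a => exact absurd (ha i (by simp)) (by omega)
            | hadd x y hx hy => simp only [map_add, mul_add, add_mul, hx, hy]
            | hsmul c x hx => simp only [map_smul, mul_smul_comm, smul_mul_assoc, hx]
          rw [hc, mul_assoc, condExp_incl_mul, condExp_T_mul_T, mul_smul_comm, mul_one]
        rw [h, h, mul_smul_comm, smul_mul_assoc]
      | succ n =>
        rw [condExp_T_incl_T, condExp_T_incl_T]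
        simp only [mul_add, add_mul, mul_smul_comm, smul_mul_assoc, map_add, map_smul,
          ocneanu_succ, condExp_mul_incl, condExp_incl_mul]
    have hT : ∀ x, ocneanu q z (n + 1) (x * T q (Fin.last n)) =
        ocneanu q z (n + 1) (T q (Fin.last n) * x) := by
      intro x
      induction x using hecke_succ_induction with
      | hincl a => exact (hincl a _).symm
      | hmid a b =>
        have := hE a b
        rw [← condExp_incl_mul, ← condExp_mul_incl] at this
        simpa only [ocneanu_succ, mul_assoc] using this
      | hadd x y hx hy => simp only [mul_add, add_mul, map_add, hx, hy]
      | hsmul c x hx => simp only [mul_smul_comm, smul_mul_assoc, map_smul, hx]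
    induction y using hecke_succ_induction generalizing x with
    | hincl a => exact hincl a x
    | hmid a b =>
      rw [← mul_assoc, hincl, ← mul_assoc, ← mul_assoc, hT, ← mul_assoc, ← mul_assoc, hincl]
      simp only [mul_assoc]
    | hadd y y' hx hy => simp only [mul_add, add_mul, map_add, hx, hy]
    | hsmul c y hx => simp only [mul_smul_comm, smul_mul_assoc, map_smul, hx]

theorem isOcneanuTrace_ocneanu : IsOcneanuTrace q z (ocneanu q z) where
  compat n a := by rw [ocneanu_succ, condExp_incl]
  one n := by
    induction n with
    | zero => exact ocneanu_zero_one q z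
    | succ n ih => rw [ocneanu_succ, condExp_one, ih]
  comm := ocneanu_comm q z
  markov n a b := by
    rw [ocneanu_succ, condExp_mul_incl, condExp_incl_mul, condExp_T, mul_smul_comm, mul_one,
      smul_mul_assoc, map_smul, smul_eq_mul]

end Trace

/-! ### The trace of a positive word -/

section WordPolynomial

open Polynomial

variable {k : Type u} [Field k]

/-- Evaluation of a polynomial over `k[w]` in `t` at `t = q` and `w = z / q`. A monomial `t ^ d`
times a coefficient in `k[w]` becomes homogeneous of total degree `d` in `q` and `z`. -/
noncomputable def evalHom {K : Type*} [Field K] [Algebra k K] (q z : K) : k[X][X] →+* K :=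
  eval₂RingHom (aeval (z / q) : k[X] →ₐ[k] K).toRingHom q

theorem evalHom_X {K : Type*} [Field K] [Algebra k K] (q z : K) :
    evalHom (k := k) q z X = q := by
  simp [evalHom]

theorem evalHom_X_mul_C_X {K : Type*} [Field K] [Algebra k K] {q : K} (hq : q ≠ 0) (z : K) :
    evalHom (k := k) q z (X * C X) = z := by
  simp [evalHom, hq]

/-- The contribution of `p` equal letters, none of them adjacent to another letter, to the lowest
coefficient of the trace of a positive word. -/
noncomputable def lowFactor (k : Type u) [Field k] : ℕ → k[X]
  | 0 => 1
  | 1 => X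
  | p + 2 => (-1) ^ p * (1 - X)

theorem lowFactor_add_two (p : ℕ) :
    lowFactor k (p + 2) = -lowFactor k (p + 1) + if p = 0 then lowFactor k 0 else 0 := by
  cases p with
  | zero => simp [lowFactor]; ring
  | succ p => simp [lowFactor, pow_succ]

/-- `IsWordPoly n a Q` says that the trace of the word `a` in `H_{n+1}(q)` is the value of `Q` at
`t = q`, `w = z / q`, for all extensions of `k` and all parameters, and describes the extreme
coefficients of `Q`: the degree in `t` is the length of `a`, and the order of vanishing at `t = 0`
is at least the number of distinct letters of `a`, with the given coefficient if
no two letters are adjacent. -/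
structure IsWordPoly (n : ℕ) (a : List ℕ) (Q : k[X][X]) : Prop where
  natDegree_le : Q.natDegree ≤ a.length
  coeff_length : Q.coeff a.length = X ^ a.toFinset.card
  dvd : X ^ a.toFinset.card ∣ Q
  coeff_card : (∀ i ∈ a, i + 1 ∉ a) →
    Q.coeff a.toFinset.card = ∏ i ∈ a.toFinset, lowFactor k (a.count i)
  trace : ∀ (K : Type u) [Field K] [Algebra k K] (q : K) (_ : q ≠ 0) (z : K)
    (Tr : ∀ i : ℕ, Hecke q i →ₗ[K] K), IsOcneanuTrace q z Tr →
      Tr n (word q n a) = evalHom q z Q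

theorem BraidEq.isWordPoly {n : ℕ} {u v : List ℕ} (h : BraidEq u v) (hu : ∀ i ∈ u, i < n)
    {Q : k[X][X]} (hQ : IsWordPoly n v Q) : IsWordPoly n u Q := by
  have hs : u.toFinset = v.toFinset := by ext x; simp [h.mem_iff x]
  refine ⟨?_, ?_, ?_, fun hadj => ?_, fun K _ _ q hq z Tr hTr => ?_⟩
  · rw [h.length_eq]; exact hQ.natDegree_le
  · rw [h.length_eq, hs]; exact hQ.coeff_length
  · rw [hs]; exact hQ.dvd
  · rw [hs, hQ.coeff_card fun i hi hi' => hadj i ((h.mem_iff i).2 hi) ((h.mem_iff _).2 hi')]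
    exact Finset.prod_congr rfl fun i _ => by rw [h.count_eq hadj]
  · rw [h.word_eq q hu]; exact hQ.trace K q hq z Tr hTr

theorem IsWordPoly.succ {n : ℕ} {a : List ℕ} (ha : ∀ i ∈ a, i < n) {Q : k[X][X]}
    (hQ : IsWordPoly n a Q) : IsWordPoly (n + 1) a Q where
  __ := hQ
  trace K _ _ q hq z Tr hTr := by
    rw [← incl_word q ha, hTr.compat, hQ.trace K q hq z Tr hTr]

theorem IsWordPoly.markov {n : ℕ} {a b : List ℕ} (ha : ∀ i ∈ a, i < n) (hb : ∀ i ∈ b, i < n)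
    {Q : k[X][X]} (hQ : IsWordPoly n (a ++ b) Q) :
    IsWordPoly (n + 1) (a ++ n :: b) (X * (C X * Q)) := by
  have hlen : (a ++ n :: b).length = (a ++ b).length + 1 := by simp; omega
  have hs : (a ++ n :: b).toFinset = insert n (a ++ b).toFinset := by
    ext x; simp only [List.mem_toFinset, List.mem_append, List.mem_cons, Finset.mem_insert]; tauto
  have hn : n ∉ a ++ b := fun h =>
    (List.mem_append.1 h).elim (fun h => (ha n h).false) fun h => (hb n h).false
  have hn' : n ∉ (a ++ b).toFinset := by rwa [List.mem_toFinset]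
  have hcount : (a ++ n :: b).count n = 1 := by
    have := List.count_eq_zero_of_not_mem hn
    simp only [List.count_append, List.count_cons_self] at this ⊢
    omega
  refine ⟨?_, ?_, ?_, fun hadj => ?_, fun K _ _ q hq z Tr hTr => ?_⟩
  · rw [hlen, add_comm]
    exact natDegree_mul_le.trans (add_le_add natDegree_X_le
      ((natDegree_C_mul_le _ _).trans hQ.natDegree_le))
  · rw [hlen, coeff_X_mul, coeff_C_mul, hQ.coeff_length, hs, Finset.card_insert_of_notMem hn',
      pow_succ']
  · rw [hs, Finset.card_insert_of_notMem hn', pow_succ']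
    exact mul_dvd_mul_left _ (hQ.dvd.mul_left _)
  · rw [hs, Finset.card_insert_of_notMem hn', coeff_X_mul, coeff_C_mul,
      hQ.coeff_card fun i hi hi' => hadj i (by simp at hi ⊢; tauto) (by simp at hi' ⊢; tauto),
      Finset.prod_insert hn', hcount]
    congr 1
    refine Finset.prod_congr rfl fun i hi => ?_
    have hin : n ≠ i := fun h => hn' (h ▸ hi)
    simp [List.count_append, List.count_cons_of_ne hin]
  · have h := hTr.markov n (word q n a) (word q n b)
    rw [incl_word q ha, incl_word q hb, ← word_append, hQ.trace K q hq z Tr hTr, mul_assoc] at h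
    rw [word_append, word_cons, ← mul_assoc X, map_mul (evalHom q z), evalHom_X_mul_C_X hq, ← h,
      T_eq_gen, Fin.val_last]

theorem IsWordPoly.square {n i : ℕ} {a b : List ℕ} (hi : i < n) {Q R : k[X][X]}
    (hQ : IsWordPoly n (a ++ i :: b) Q) (hR : IsWordPoly n (a ++ b) R) :
    IsWordPoly n (a ++ i :: i :: b) ((X - 1) * Q + X * R) := by
  have hlen : (a ++ i :: i :: b).length = (a ++ b).length + 2 := by simp; omega
  have hlen' : (a ++ i :: b).length = (a ++ b).length + 1 := by simp; omega
  have hs : (a ++ i :: i :: b).toFinset = insert i (a ++ b).toFinset := by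
    ext x; simp only [List.mem_toFinset, List.mem_append, List.mem_cons, Finset.mem_insert]; tauto
  have hs' : (a ++ i :: b).toFinset = insert i (a ++ b).toFinset := by
    ext x; simp only [List.mem_toFinset, List.mem_append, List.mem_cons, Finset.mem_insert]; tauto
  have hQd := hQ.natDegree_le
  have hQl := hQ.coeff_length
  have hQdvd := hQ.dvd
  have hQlow := hQ.coeff_card
  have hRd := hR.natDegree_le
  have hRdvd := hR.dvd
  have hRlow := hR.coeff_card
  rw [hlen'] at hQd hQl
  rw [hs'] at hQl hQdvd hQlow
  set S := (a ++ b).toFinset with hS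
  refine ⟨?_, ?_, ?_, fun hadj => ?_, fun K _ _ q hq z Tr hTr => ?_⟩
  · rw [hlen]
    refine (natDegree_add_le _ _).trans (max_le ?_ ?_)
    · refine natDegree_mul_le.trans ?_
      have : (X - 1 : k[X][X]).natDegree ≤ 1 := by
        simpa using natDegree_X_sub_C_le (1 : k[X])
      omega
    · refine natDegree_mul_le.trans ?_
      have : (X : k[X][X]).natDegree ≤ 1 := natDegree_X_le
      omega
  · rw [hlen, hs, sub_mul, one_mul, coeff_add, coeff_sub, coeff_X_mul, coeff_X_mul, hQl,
      coeff_eq_zero_of_natDegree_lt (by omega : Q.natDegree < _),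
      coeff_eq_zero_of_natDegree_lt (by omega : R.natDegree < _), sub_zero, add_zero]
  · rw [hs]
    refine dvd_add (hQdvd.mul_left _) ?_
    refine (pow_dvd_pow X (Finset.card_insert_le i S)).trans ?_
    rw [pow_succ']
    exact mul_dvd_mul_left _ hRdvd
  · rw [hs]
    have hadjQ : ∀ j ∈ a ++ i :: b, j + 1 ∉ a ++ i :: b := fun j hj hj' =>
      hadj j (by simp at hj ⊢; tauto) (by simp at hj' ⊢; tauto)
    have hadjR : ∀ j ∈ a ++ b, j + 1 ∉ a ++ b := fun j hj hj' =>
      hadj j (by simp at hj ⊢; tauto) (by simp at hj' ⊢; tauto)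
    replace hQlow := hQlow hadjQ
    replace hRlow := hRlow hadjR
    have hmem : i ∈ insert i S := Finset.mem_insert_self _ _
    have hp1 : (a ++ i :: i :: b).count i = (a ++ b).count i + 2 := by
      simp only [List.count_append, List.count_cons_self]; omega
    have hp2 : (a ++ i :: b).count i = (a ++ b).count i + 1 := by
      simp only [List.count_append, List.count_cons_self]; omega
    rw [← Finset.mul_prod_erase _ _ hmem, hp2] at hQlow
    rw [← Finset.mul_prod_erase _ _ hmem, hp1, lowFactor_add_two]
    have hprod1 : ∏ j ∈ (insert i S).erase i, lowFactor k ((a ++ i :: i :: b).count j) =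
        ∏ j ∈ (insert i S).erase i, lowFactor k ((a ++ b).count j) := by
      refine Finset.prod_congr rfl fun j hj => ?_
      have hij : i ≠ j := (Finset.ne_of_mem_erase hj).symm
      simp [List.count_append, List.count_cons_of_ne hij]
    have hprod2 : ∏ j ∈ (insert i S).erase i, lowFactor k ((a ++ i :: b).count j) =
        ∏ j ∈ (insert i S).erase i, lowFactor k ((a ++ b).count j) := by
      refine Finset.prod_congr rfl fun j hj => ?_
      have hij : i ≠ j := (Finset.ne_of_mem_erase hj).symm
      simp [List.count_append, List.count_cons_of_ne hij]
    rw [hprod1]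
    rw [hprod2] at hQlow
    obtain ⟨s, hcard⟩ : ∃ s, (insert i S).card = s + 1 :=
      ⟨_, (Nat.succ_pred_eq_of_pos (Finset.card_pos.2 ⟨i, hmem⟩)).symm⟩
    rw [hcard] at hQdvd hQlow ⊢
    rw [sub_mul, one_mul, coeff_add, coeff_sub, coeff_X_mul, coeff_X_mul, hQlow,
      X_pow_dvd_iff.1 hQdvd s (by omega)]
    -- `R` contributes only if the two letters `i` were the only ones, since otherwise it
    -- vanishes to the order `s + 1`.
    by_cases hiS : i ∈ S
    · have hpos : 0 < (a ++ b).count i := List.count_pos_iff.2 (List.mem_toFinset.1 hiS)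
      rw [Finset.insert_eq_of_mem hiS] at hcard
      rw [if_neg hpos.ne', X_pow_dvd_iff.1 hRdvd s (by omega)]
      ring
    · have hz : (a ++ b).count i = 0 :=
        List.count_eq_zero_of_not_mem fun h => hiS (List.mem_toFinset.2 h)
      rw [Finset.card_insert_of_notMem hiS, Nat.succ_inj] at hcard
      rw [hcard] at hRlow
      rw [if_pos hz, hRlow, Finset.erase_insert hiS]
      simp only [lowFactor]
      ring
  · rw [word_square q hi, map_add, map_smul, map_smul, hQ.trace K q hq z Tr hTr,
      hR.trace K q hq z Tr hTr, map_add, map_mul, map_mul, map_sub, evalHom_X, map_one,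
      smul_eq_mul, smul_eq_mul]

theorem isWordPoly_nil : IsWordPoly 0 [] (1 : k[X][X]) where
  natDegree_le := by simp
  coeff_length := by simp
  dvd := by simp
  coeff_card := by simp
  trace K _ _ q hq z Tr hTr := by simp [hTr.one]

theorem exists_isWordPoly (k : Type u) [Field k] {n : ℕ} {a : List ℕ} (ha : ∀ i ∈ a, i < n) :
    ∃ Q : k[X][X], IsWordPoly n a Q := by
  induction hl : a.length + n using Nat.strong_induction_on generalizing a n with
  | _ l ih =>
  subst hl
  cases n with
  | zero =>
    cases a with
    | nil => exact ⟨1, isWordPoly_nil⟩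
    | cons i a => exact absurd (ha i (by simp)) (by omega)
  | succ n =>
  obtain ⟨a', haa, ha'⟩ :=
    exists_braidEq_square_or_count_le_one n a fun i hi => Nat.lt_succ_iff.1 (ha i hi)
  suffices h : ∃ Q : k[X][X], IsWordPoly (n + 1) a' Q by
    obtain ⟨Q, hQ⟩ := h
    exact ⟨Q, haa.isWordPoly ha hQ⟩
  have hlt : ∀ i ∈ a', i < n + 1 := fun i hi => ha i ((haa.mem_iff i).2 hi)
  have hlen := haa.length_eq
  obtain ⟨b, i, c, rfl⟩ | ha' := ha'
  · simp only [List.length_append, List.length_cons] at hlen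
    obtain ⟨Q, hQ⟩ := @ih _ (by simp; omega) (n + 1) (b ++ i :: c)
      (fun j hj => hlt j (by simp at hj ⊢; tauto)) rfl
    obtain ⟨R, hR⟩ := @ih _ (by simp; omega) (n + 1) (b ++ c)
      (fun j hj => hlt j (by simp at hj ⊢; tauto)) rfl
    exact ⟨_, hQ.square (hlt i (by simp)) hR⟩
  by_cases hmem : n ∈ a'
  · obtain ⟨b, c, rfl, hb⟩ := List.eq_append_cons_of_mem hmem
    have hc : n ∉ c := fun hc => by
      have := List.count_pos_iff.2 hc
      simp at ha'
      omega
    have hb' : ∀ i ∈ b, i < n := fun i hi =>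
      lt_of_le_of_ne (Nat.lt_succ_iff.1 (hlt i (by simp [hi]))) fun h => hb (h ▸ hi)
    have hc' : ∀ i ∈ c, i < n := fun i hi =>
      lt_of_le_of_ne (Nat.lt_succ_iff.1 (hlt i (by simp [hi]))) fun h => hc (h ▸ hi)
    simp only [List.length_append, List.length_cons] at hlen
    obtain ⟨Q, hQ⟩ := @ih _ (by simp; omega) n (b ++ c)
      (fun j hj => (List.mem_append.1 hj).elim (hb' j) (hc' j)) rfl
    exact ⟨_, hQ.markov hb' hc'⟩
  · have hlt' : ∀ i ∈ a', i < n := fun i hi =>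
      lt_of_le_of_ne (Nat.lt_succ_iff.1 (hlt i hi)) fun h => hmem (h ▸ hi)
    obtain ⟨Q, hQ⟩ := @ih _ (by omega) n a' hlt' rfl
    exact ⟨Q, hQ.succ hlt'⟩

theorem existsUnique_isOcneanuTrace {K : Type u} [Field K] {q : K} (hq : q ≠ 0) (z : K) :
    ∃! Tr : ∀ i : ℕ, Hecke q i →ₗ[K] K, IsOcneanuTrace q z Tr := by
  refine ⟨ocneanu q z, isOcneanuTrace_ocneanu q z, fun Tr hTr => ?_⟩
  funext n
  refine LinearMap.ext fun x => ?_
  induction x using word_induction with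
  | hword a ha =>
    obtain ⟨Q, hQ⟩ := exists_isWordPoly K ha
    rw [hQ.trace K q hq z Tr hTr, hQ.trace K q hq z _ (isOcneanuTrace_ocneanu q z)]
  | hadd x y hx hy => rw [map_add, map_add, hx, hy]
  | hsmul c x hx => rw [map_smul, map_smul, hx]

end WordPolynomial

/-! ### The trace of a signed word -/

section SignedWords

open Polynomial

/-- The letter `(i, true)` stands for `T_i`, the letter `(i, false)` for
`q T_i⁻¹ = T_i + (1 - q)`. -/
noncomputable def signedGen {K : Type*} [Field K] (q : K) (n : ℕ) (x : ℕ × Bool) : Hecke q n :=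
  if x.2 then gen q n x.1 else gen q n x.1 + (1 - q) • 1

/-- The element of `H_{n+1}(q)` spelled by a signed word. -/
noncomputable def signedWord {K : Type*} [Field K] (q : K) (n : ℕ) (v : List (ℕ × Bool)) :
    Hecke q n :=
  (v.map (signedGen q n)).prod

theorem signedWord_cons {K : Type*} [Field K] (q : K) (n : ℕ) (x : ℕ × Bool)
    (v : List (ℕ × Bool)) : signedWord q n (x :: v) = signedGen q n x * signedWord q n v := by
  simp [signedWord]

/-- The positive letters of a signed word. -/
def positivePart : List (ℕ × Bool) → List ℕ
  | [] => []
  | (i, true) :: v => i :: positivePart v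
  | (_, false) :: v => positivePart v

theorem mem_positivePart {i : ℕ} {v : List (ℕ × Bool)} : i ∈ positivePart v ↔ (i, true) ∈ v := by
  induction v with
  | nil => simp [positivePart]
  | cons x v ih =>
    obtain ⟨j, _ | _⟩ := x <;> simp [positivePart, ih]

variable (k : Type u) [Field k]

open Classical in
/-- A polynomial that describes the trace of a positive word. -/
noncomputable def wordPoly (n : ℕ) (a : List ℕ) : k[X][X] :=
  if h : ∃ Q : k[X][X], IsWordPoly n a Q then h.choose else 0

theorem isWordPoly_wordPoly {n : ℕ} {a : List ℕ} (ha : ∀ i ∈ a, i < n) :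
    IsWordPoly n a (wordPoly k n a) := by
  have h := exists_isWordPoly k ha
  rw [wordPoly, dif_pos h]
  exact h.choose_spec

/-- A polynomial that describes the trace of the product of a positive word and a signed word,
obtained by expanding every factor `T_i + (1 - q)`. -/
noncomputable def signedPoly (n : ℕ) : List ℕ → List (ℕ × Bool) → k[X][X]
  | a, [] => wordPoly k n a
  | a, (i, true) :: v => signedPoly n (a ++ [i]) v
  | a, (i, false) :: v => signedPoly n (a ++ [i]) v + (1 - X) * signedPoly n a v

variable {n : ℕ}

theorem forall_mem_append_singleton {a : List ℕ} {i : ℕ} (ha : ∀ j ∈ a, j < n) (hi : i < n) :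
    ∀ j ∈ a ++ [i], j < n := by
  intro j hj
  rcases List.mem_append.1 hj with h | h
  · exact ha j h
  · rwa [List.mem_singleton.1 h]

variable {k} in
theorem trace_signedWord {K : Type u} [Field K] [Algebra k K] {q : K} (hq : q ≠ 0) (z : K)
    {Tr : ∀ i : ℕ, Hecke q i →ₗ[K] K} (hTr : IsOcneanuTrace q z Tr) (v : List (ℕ × Bool)) :
    ∀ a : List ℕ, (∀ i ∈ a, i < n) → (∀ x ∈ v, x.1 < n) →
      Tr n (word q n a * signedWord q n v) = evalHom q z (signedPoly k n a v) := by
  induction v with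
  | nil =>
    intro a ha _
    simpa [signedWord, signedPoly] using (isWordPoly_wordPoly k ha).trace K q hq z Tr hTr
  | cons x v ih =>
    intro a ha hv
    have hi := hv x (by simp)
    have h1 := ih _ (forall_mem_append_singleton ha hi) fun y hy => hv y (by simp [hy])
    rw [word_append, word_cons, word_nil, mul_one] at h1
    obtain ⟨i, _ | _⟩ := x
    · rw [signedWord_cons, signedPoly, map_add, map_mul (evalHom q z), map_sub, map_one, evalHom_X,
        ← h1,
        ← ih _ ha fun y hy => hv y (by simp [hy])]
      simp only [signedGen, Bool.false_eq_true, if_false, add_mul, mul_add, smul_mul_assoc,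
        mul_smul_comm, one_mul, map_add, map_smul, smul_eq_mul, mul_assoc]
    · rw [signedWord_cons, signedPoly, ← h1, ← mul_assoc]
      rfl

/-- The contribution to the leading coefficient of the trace of a signed word, of `p` positive and
`m` negative occurrences of the same letter. -/
noncomputable def topFactor : ℕ → ℕ → k[X]
  | 0, 0 => 1
  | 0, m + 1 => (-1) ^ (m + 1) * (1 - X)
  | _ + 1, 0 => X
  | _ + 1, _ + 1 => 0

theorem topFactor_succ (p m : ℕ) :
    topFactor k p (m + 1) = topFactor k (p + 1) m - topFactor k p m := by
  cases p <;> cases m <;> simp [topFactor, pow_succ]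

theorem one_sub_X_ne_zero : (1 - X : k[X]) ≠ 0 := by
  intro h
  simpa using congrArg (Polynomial.eval 0) h

theorem topFactor_ne_zero {p m : ℕ} (h : p = 0 ∨ m = 0) : topFactor k p m ≠ 0 := by
  rcases p with _ | p <;> rcases m with _ | m
  · simp [topFactor]
  · simp [topFactor, one_sub_X_ne_zero]
  · simp [topFactor]
  · omega

theorem lowFactor_ne_zero (p : ℕ) : lowFactor k p ≠ 0 := by
  rcases p with _ | _ | p
  · simp [lowFactor]
  · simp [lowFactor]
  · simp [lowFactor, one_sub_X_ne_zero]

theorem prod_topFactor_succ {s : Finset ℕ} {i : ℕ} (hi : i ∈ s) (p m : ℕ → ℕ) :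
    ∏ j ∈ s, topFactor k (p j) (m j + if i = j then 1 else 0) =
      ∏ j ∈ s, topFactor k (p j + if i = j then 1 else 0) (m j) -
        ∏ j ∈ s, topFactor k (p j) (m j) := by
  rw [← Finset.mul_prod_erase s _ hi, ← Finset.mul_prod_erase s _ hi,
    ← Finset.mul_prod_erase s _ hi, if_pos rfl, topFactor_succ]
  have h : ∀ j ∈ s.erase i, (if i = j then 1 else 0) = 0 := fun j hj =>
    if_neg (Finset.ne_of_mem_erase hj).symm
  have h1 : ∏ j ∈ s.erase i, topFactor k (p j) (m j + if i = j then 1 else 0) =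
      ∏ j ∈ s.erase i, topFactor k (p j) (m j) :=
    Finset.prod_congr rfl fun j hj => by rw [h j hj, add_zero]
  have h2 : ∏ j ∈ s.erase i, topFactor k (p j + if i = j then 1 else 0) (m j) =
      ∏ j ∈ s.erase i, topFactor k (p j) (m j) :=
    Finset.prod_congr rfl fun j hj => by rw [h j hj, add_zero]
  rw [h1, h2, sub_mul]

theorem signedPoly_top (v : List (ℕ × Bool)) :
    ∀ a : List ℕ, (∀ i ∈ a, i < n) → (∀ x ∈ v, x.1 < n) →
      (signedPoly k n a v).natDegree ≤ a.length + v.length ∧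
      (signedPoly k n a v).coeff (a.length + v.length) =
        ∏ i ∈ Finset.range n,
          topFactor k (a.count i + v.count (i, true)) (v.count (i, false)) := by
  induction v with
  | nil =>
    intro a ha _
    have h := isWordPoly_wordPoly k ha
    refine ⟨h.natDegree_le, h.coeff_length.trans ?_⟩
    have hs : a.toFinset ⊆ Finset.range n := fun i hi =>
      Finset.mem_range.2 (ha i (List.mem_toFinset.1 hi))
    rw [← Finset.prod_subset hs, ← Finset.prod_const]
    · refine Finset.prod_congr rfl fun i hi => ?_
      obtain ⟨c, hc⟩ := Nat.exists_eq_succ_of_ne_zero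
        (List.count_pos_iff.2 (List.mem_toFinset.1 hi)).ne'
      simp [hc, topFactor]
    · intro i _ hi
      rw [List.count_eq_zero_of_not_mem fun h => hi (List.mem_toFinset.2 h)]
      simp [topFactor]
  | cons x v ih =>
    intro a ha hv
    have hi := hv x (by simp)
    have hv' : ∀ y ∈ v, y.1 < n := fun y hy => hv y (by simp [hy])
    obtain ⟨h1, h2⟩ := ih _ (forall_mem_append_singleton ha hi) hv'
    rw [List.length_append, List.length_singleton,
      show a.length + 1 + v.length = a.length + v.length + 1 by ring] at h1 h2
    rw [List.length_cons, ← add_assoc]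
    obtain ⟨i, _ | _⟩ := x
    · obtain ⟨h3, h4⟩ := ih _ ha hv'
      rw [signedPoly]
      constructor
      · refine (natDegree_add_le _ _).trans (max_le h1 ?_)
        refine natDegree_mul_le.trans ?_
        have : (1 - X : k[X][X]).natDegree ≤ 1 := by
          rw [natDegree_sub]
          simpa using natDegree_X_sub_C_le (1 : k[X])
        omega
      · rw [sub_mul, one_mul, coeff_add, coeff_sub, coeff_X_mul, h2, h4,
          coeff_eq_zero_of_natDegree_lt (by omega : (signedPoly k n a v).natDegree < _), zero_sub,
          ← sub_eq_add_neg]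
        have := prod_topFactor_succ k (Finset.mem_range.2 hi)
          (fun j => a.count j + v.count (j, true)) fun j => v.count (j, false)
        simp only [List.count_append, List.count_cons, List.count_nil, zero_add, beq_iff_eq,
          Prod.mk.injEq, and_true, and_false, Bool.false_eq_true, if_false, add_zero,
          add_right_comm] at this ⊢
        exact this.symm
    · rw [signedPoly]
      refine ⟨h1, h2.trans (Finset.prod_congr rfl fun j _ => ?_)⟩
      simp only [List.count_append, List.count_cons, List.count_nil, zero_add, beq_iff_eq,
          Prod.mk.injEq, and_true, and_false, Bool.true_eq_false, if_false, add_zero]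
      congr 1
      ring

theorem dvd_signedPoly (v : List (ℕ × Bool)) :
    ∀ a : List ℕ, (∀ i ∈ a, i < n) → (∀ x ∈ v, x.1 < n) →
      X ^ (a ++ positivePart v).toFinset.card ∣ signedPoly k n a v := by
  induction v with
  | nil =>
    intro a ha _
    simpa [positivePart, signedPoly] using (isWordPoly_wordPoly k ha).dvd
  | cons x v ih =>
    intro a ha hv
    have hv' : ∀ y ∈ v, y.1 < n := fun y hy => hv y (by simp [hy])
    have h1 := ih _ (forall_mem_append_singleton ha (hv x (by simp))) hv'
    rw [List.append_assoc, List.singleton_append] at h1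
    obtain ⟨i, _ | _⟩ := x
    · rw [signedPoly, positivePart]
      refine dvd_add ((pow_dvd_pow X (Finset.card_le_card ?_)).trans h1)
        ((ih _ ha hv').mul_left _)
      intro j hj
      simp only [List.mem_toFinset, List.mem_append, List.mem_cons] at hj ⊢
      tauto
    · exact h1

/-- If no letter occurs with both signs, then only the summand `1` of the factors
`T_i + (1 - q)` contributes in the lowest degree: the summand `T_i` adds a new letter, and the
summand `-q` has degree one. -/
theorem dvd_signedPoly_sub_wordPoly (v : List (ℕ × Bool)) :
    ∀ a : List ℕ, (∀ i ∈ a, i < n) → (∀ x ∈ v, x.1 < n) →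
      (∀ i, (i, false) ∈ v → i ∉ a ++ positivePart v) →
      X ^ ((a ++ positivePart v).toFinset.card + 1) ∣
        signedPoly k n a v - wordPoly k n (a ++ positivePart v) := by
  induction v with
  | nil => simp [positivePart, signedPoly]
  | cons x v ih =>
    intro a ha hv hd
    have hv' : ∀ y ∈ v, y.1 < n := fun y hy => hv y (by simp [hy])
    have ha' := forall_mem_append_singleton ha (hv x (by simp))
    obtain ⟨i, _ | _⟩ := x
    · rw [signedPoly, positivePart]
      have h1 := dvd_signedPoly k v _ ha' hv'
      have h2 := ih _ ha hv' fun j hj => hd j (by simp [hj])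
      have h3 := dvd_signedPoly k v _ ha hv'
      have hi : i ∉ (a ++ positivePart v).toFinset := by
        rw [List.mem_toFinset]
        exact hd i (by simp)
      have hs : (a ++ [i] ++ positivePart v).toFinset =
          insert i (a ++ positivePart v).toFinset := by
        ext j
        simp only [List.mem_toFinset, List.mem_append, List.mem_singleton, Finset.mem_insert]
        tauto
      rw [hs, Finset.card_insert_of_notMem hi] at h1
      have h4 : X ^ ((a ++ positivePart v).toFinset.card + 1) ∣ X * signedPoly k n a v := by
        rw [pow_succ']
        exact mul_dvd_mul_left _ h3
      convert (dvd_add h1 h2).sub h4 using 1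
      ring
    · have h := ih _ ha' hv'
      rw [List.append_assoc, List.singleton_append] at h
      rw [signedPoly]
      exact h fun j hj => hd j (by simp [hj])

end SignedWords

/-! ### The weaving braid -/

section Weaving

open Polynomial

/-- The signed word `1, -2, 3, …` of the braid `σ₁ σ₂⁻¹ σ₃ ⋯`, repeated `m` times. -/
def weavingWord (n m : ℕ) : List (ℕ × Bool) :=
  (List.replicate m ((List.range n).map fun i => (i, decide (Even i)))).flatten

theorem mem_weavingWord {n m : ℕ} (hm : 1 ≤ m) {x : ℕ × Bool} :
    x ∈ weavingWord n m ↔ x.1 < n ∧ x.2 = decide (Even x.1) := by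
  obtain ⟨i, b⟩ := x
  simp only [weavingWord, List.mem_flatten, List.mem_replicate]
  constructor
  · rintro ⟨_, ⟨_, rfl⟩, hx⟩
    obtain ⟨j, hj, rfl, rfl⟩ := List.mem_map.1 hx
    exact ⟨List.mem_range.1 hj, rfl⟩
  · rintro ⟨hi, hb⟩
    exact ⟨_, ⟨by omega, rfl⟩, List.mem_map.2 ⟨i, List.mem_range.2 hi, by rw [hb]⟩⟩

theorem length_weavingWord (n m : ℕ) : (weavingWord n m).length = m * n := by
  simp [weavingWord]

theorem prod_map_smul {K A ι : Type*} [Field K] [Ring A] [Algebra K A] (l : List ι) (c : ι → K)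
    (f : ι → A) : (l.map fun i => c i • f i).prod = (l.map c).prod • (l.map f).prod := by
  induction l with
  | nil => simp
  | cons i l ih => simp [ih, smul_smul, mul_comm]

theorem prod_ite_even {K : Type*} [Field K] (c : K) (n : ℕ) :
    ((List.range n).map fun i => if Even i then 1 else c).prod = c ^ (n / 2) := by
  induction n with
  | zero => simp
  | succ n ih =>
    rw [List.range_succ, List.map_append, List.prod_append, ih]
    by_cases h : Even n
    · obtain ⟨t, rfl⟩ := h
      simp [show (t + t + 1) / 2 = (t + t) / 2 by omega]
    · obtain ⟨t, rfl⟩ := Nat.not_even_iff_odd.1 h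
      simp [show (2 * t + 1 + 1) / 2 = (2 * t + 1) / 2 + 1 by omega, pow_succ]

theorem rho_sigma {K : Type*} [Field K] {q : K} (hq : q ≠ 0) {n : ℕ} (i : Fin n) :
    rho q hq n (sigma i) = Tunit q hq i := by
  simp [rho, sigma]

/-- Up to the power of `q` from `T_i⁻¹ = q⁻¹ (T_i + (1 - q))`, the image of the weaving braid is
spelled by `weavingWord`. -/
theorem rho_weavingBraid {K : Type*} [Field K] {q : K} (hq : q ≠ 0) (n m : ℕ) :
    (rho q hq n (weavingBraid n m) : Hecke q n) =
      (q ^ (m * (n / 2)))⁻¹ • signedWord q n (weavingWord n m) := by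
  have h : ((rho q hq n (List.ofFn fun i : Fin n =>
      if Even (i : ℕ) then sigma i else (sigma i)⁻¹).prod : (Hecke q n)ˣ) : Hecke q n) =
      ((List.range n).map fun i => (if Even i then 1 else q⁻¹ : K) •
        signedGen q n (i, decide (Even i))).prod := by
    rw [← Units.coeHom_apply, map_list_prod, map_list_prod, List.map_map, List.map_ofFn,
      ← List.map_coe_finRange_eq_range, List.map_map, List.ofFn_eq_map]
    congr 1
    refine List.map_congr_left fun i _ => ?_
    by_cases hi : Even (i : ℕ)
    · simp [hi, rho_sigma, signedGen, Tunit, ← T_eq_gen]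
    · have hinv : ((Tunit q hq i)⁻¹ : (Hecke q n)ˣ).val =
          q⁻¹ • (T q i + algebraMap K (Hecke q n) (1 - q)) := rfl
      simp [hi, rho_sigma, signedGen, hinv, ← T_eq_gen, Algebra.algebraMap_eq_smul_one]
  rw [weavingBraid, map_pow, Units.val_pow_eq_pow_val, 
    h.trans (prod_map_smul (List.range n) (fun i => if Even i then 1 else q⁻¹)
      fun i => signedGen q n (i, decide (Even i))), prod_ite_even, _root_.smul_pow,
    ← pow_mul, inv_pow, mul_comm (n / 2)]
  congr 1
  simp only [signedWord, weavingWord, List.map_flatten, List.map_replicate, List.map_map]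
  rw [List.prod_flatten, List.map_replicate, List.prod_replicate]
  rfl

theorem mem_positivePart_weavingWord {n m i : ℕ} (hm : 1 ≤ m) :
    i ∈ positivePart (weavingWord n m) ↔ i < n ∧ Even i := by
  rw [mem_positivePart, mem_weavingWord hm]
  simp

theorem card_positivePart_weavingWord {n m : ℕ} (hm : 1 ≤ m) :
    (positivePart (weavingWord n m)).toFinset.card = n - n / 2 := by
  have h : (positivePart (weavingWord n m)).toFinset = {i ∈ Finset.range n | Even i} := by
    ext i
    simp [mem_positivePart_weavingWord hm]
  rw [h]
  clear h
  induction n with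
  | zero => simp
  | succ n ih =>
    rw [Finset.range_add_one, Finset.filter_insert]
    by_cases h : Even n
    · rw [if_pos h, Finset.card_insert_of_notMem (by simp), ih]
      obtain ⟨t, rfl⟩ := h
      omega
    · rw [if_neg h, ih]
      obtain ⟨t, rfl⟩ := Nat.not_even_iff_odd.1 h
      omega

variable (k : Type u) [Field k]

/-- The polynomial of the weaving word has degree exactly `m n` and order exactly
`n - ⌊n/2⌋` in the first variable. -/
theorem signedPoly_weavingWord {n m : ℕ} (hm : 1 ≤ m) :
    (∀ e, (signedPoly k n [] (weavingWord n m)).coeff e ≠ 0 → n - n / 2 ≤ e ∧ e ≤ m * n) ∧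
    (signedPoly k n [] (weavingWord n m)).coeff (n - n / 2) ≠ 0 ∧
    (signedPoly k n [] (weavingWord n m)).coeff (m * n) ≠ 0 := by
  have hlt : ∀ x ∈ weavingWord n m, x.1 < n := fun x hx => ((mem_weavingWord hm).1 hx).1
  have hcard := card_positivePart_weavingWord (n := n) hm
  obtain ⟨h1, h2⟩ := signedPoly_top k _ [] (by simp) hlt
  have h3 := dvd_signedPoly k _ [] (by simp) hlt
  have h4 := dvd_signedPoly_sub_wordPoly k _ [] (by simp) hlt (fun i hi hi' => by
    rw [List.nil_append, mem_positivePart] at hi'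
    rw [mem_weavingWord hm] at hi hi'
    exact Bool.false_ne_true (hi.2.trans hi'.2.symm))
  rw [List.length_nil, zero_add, length_weavingWord] at h1 h2
  rw [List.nil_append, hcard] at h3 h4
  refine ⟨fun e he => ⟨?_, ?_⟩, ?_, ?_⟩
  · by_contra! h
    exact he (X_pow_dvd_iff.1 h3 e h)
  · by_contra! h
    exact he (coeff_eq_zero_of_natDegree_lt (by omega))
  · have h := X_pow_dvd_iff.1 h4 _ (Nat.lt_succ_self _)
    rw [coeff_sub, sub_eq_zero] at h
    have hw := (isWordPoly_wordPoly k (n := n) (a := positivePart (weavingWord n m))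
      fun i hi => ((mem_positivePart_weavingWord hm).1 hi).1).coeff_card (fun i hi hi' => by
        rw [mem_positivePart_weavingWord hm] at hi hi'
        exact (Nat.even_add_one.1 hi'.2) hi.2)
    rw [hcard] at hw
    rw [h, hw]
    exact Finset.prod_ne_zero_iff.2 fun i _ => lowFactor_ne_zero k _
  · rw [h2]
    refine Finset.prod_ne_zero_iff.2 fun i _ => topFactor_ne_zero k ?_
    simp only [List.count_eq_zero, mem_weavingWord hm, List.count_nil, zero_add]
    by_cases h : Even i <;> simp [h]

end Weaving

/-! ### Two-variable Laurent polynomials -/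

section Laurent

open Polynomial

variable {k : Type u} [Field k]

/-- The Laurent polynomial `q ^ (-N) Q(q, z / q)` of a polynomial `Q` in `t` over `k[w]`, evaluated
at `t = q` and `w = z / q`. -/
noncomputable def toLaurent (N : ℕ) (Q : k[X][X]) : Laurent₂ k :=
  .ofCoeff <| Finsupp.onFinset
    ((Q.support.sigma fun e => (Q.coeff e).support).image
      fun x : (_ : ℕ) × ℕ => ((x.1 : ℤ) - x.2 - N, (x.2 : ℤ)))
    (fun x => if 0 ≤ x.2 ∧ 0 ≤ x.1 + x.2 + N then
      (Q.coeff (x.1 + x.2 + N).toNat).coeff x.2.toNat else 0)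
    (by
      rintro ⟨a, b⟩ h
      rw [ite_ne_right_iff] at h
      obtain ⟨⟨hb, hab⟩, h⟩ := h
      refine Finset.mem_image.2 ⟨⟨(a + b + N).toNat, b.toNat⟩, ?_, ?_⟩
      · simp only [Finset.mem_sigma, mem_support_iff]
        exact ⟨fun h' => h (by rw [h', coeff_zero]), h⟩
      · simp only [Int.toNat_of_nonneg hb, Int.toNat_of_nonneg hab, Prod.mk.injEq, and_true]
        ring)

theorem coeff_toLaurent (N : ℕ) (Q : k[X][X]) (e j : ℕ) :
    (toLaurent N Q).coeff ((e : ℤ) - j - N, (j : ℤ)) = (Q.coeff e).coeff j := by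
  simp only [toLaurent, AddMonoidAlgebra.coeff_ofCoeff, Finsupp.onFinset_apply]
  rw [show (e : ℤ) - j - N + j + N = e by ring, if_pos ⟨by positivity, by positivity⟩,
    Int.toNat_natCast, Int.toNat_natCast]

theorem eval_toLaurent {K : Type*} [Field K] [Algebra k K] {q : K} (hq : q ≠ 0) (z : K) (N : ℕ)
    (Q : k[X][X]) : (toLaurent N Q).eval q z = (q ^ N)⁻¹ * evalHom q z Q := by
  have hinj : Function.Injective
      fun x : (_ : ℕ) × ℕ => ((x.1 : ℤ) - x.2 - N, (x.2 : ℤ)) := by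
    rintro ⟨e, j⟩ ⟨e', j'⟩ h
    simp only [Prod.mk.injEq] at h
    obtain rfl : j = j' := by omega
    obtain rfl : e = e' := by omega
    rfl
  have hsupp : (toLaurent N Q).coeff.support ⊆
      (Q.support.sigma fun e => (Q.coeff e).support).image
        fun x : (_ : ℕ) × ℕ => ((x.1 : ℤ) - x.2 - N, (x.2 : ℤ)) := by
    simp only [toLaurent, AddMonoidAlgebra.coeff_ofCoeff]
    exact Finsupp.support_onFinset_subset
  rw [Laurent₂.eval, Finset.sum_subset hsupp, Finset.sum_image hinj.injOn, Finset.sum_sigma,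
    evalHom, coe_eval₂RingHom, eval₂_eq_sum, Polynomial.sum, Finset.mul_sum]
  · refine Finset.sum_congr rfl fun e _ => ?_
    have h : (aeval (z / q) : k[X] →ₐ[k] K).toRingHom (Q.coeff e) =
        ∑ j ∈ (Q.coeff e).support, algebraMap k K ((Q.coeff e).coeff j) * (z / q) ^ j := by
      simp [aeval_def, eval₂_eq_sum, Polynomial.sum]
    rw [h, Finset.sum_mul, Finset.mul_sum]
    refine Finset.sum_congr rfl fun j _ => ?_
    rw [coeff_toLaurent, zpow_sub₀ hq, zpow_sub₀ hq]
    simp only [zpow_natCast, div_pow]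
    field_simp
  · intro x _ hx
    rw [Finsupp.notMem_support_iff.1 hx, map_zero, zero_mul, zero_mul]

theorem mem_degrees_toLaurent {N : ℕ} {Q : k[X][X]} {s : ℤ} :
    s ∈ (toLaurent N Q).degrees ↔ ∃ e : ℕ, Q.coeff e ≠ 0 ∧ s = e - N := by
  constructor
  · rintro ⟨a, b, h, rfl⟩
    simp only [toLaurent, AddMonoidAlgebra.coeff_ofCoeff, Finsupp.onFinset_apply] at h
    rw [ite_ne_right_iff] at h
    obtain ⟨⟨hb, hab⟩, h⟩ := h
    refine ⟨_, fun h' => h (by rw [h', coeff_zero]), ?_⟩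
    rw [Int.toNat_of_nonneg hab]
    ring
  · rintro ⟨e, he, rfl⟩
    obtain ⟨j, hj⟩ : ∃ j, (Q.coeff e).coeff j ≠ 0 := by
      by_contra! h
      exact he (Polynomial.ext (by simpa using h))
    exact ⟨_, _, by rwa [coeff_toLaurent], by ring⟩

end Laurent

end WeavingTrace

theorem proposition5 (k : Type u) [Field k] (n m : ℕ) (hm : 1 ≤ m)
    (d r : ℤ) (hd : 2 * d = 1 - (-1) ^ n) (hr : 2 * r = (n : ℤ) - d) :
    ∃ P : WeavingTrace.Laurent₂ k,
      (∀ (K : Type u) [Field K] [Algebra k K] (q : K) (hq : q ≠ 0) (z : K),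
        (∃! Tr : ∀ i : ℕ, WeavingTrace.Hecke q i →ₗ[K] K,
          WeavingTrace.IsOcneanuTrace q z Tr) ∧
        ∀ Tr : ∀ i : ℕ, WeavingTrace.Hecke q i →ₗ[K] K,
          WeavingTrace.IsOcneanuTrace q z Tr →
          Tr n (WeavingTrace.rho q hq n (WeavingTrace.weavingBraid n m)) = P.eval q z) ∧
      IsGreatest P.degrees (m * n - m * r) ∧
      IsLeast P.degrees (r + d - m * r) := by
  have hrn : r = ((n / 2 : ℕ) : ℤ) ∧ r + d = ((n - n / 2 : ℕ) : ℤ) := by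
    rcases Nat.even_or_odd n with h | h
    · rw [h.neg_one_pow] at hd
      obtain ⟨t, rfl⟩ := h
      omega
    · rw [h.neg_one_pow] at hd
      obtain ⟨t, rfl⟩ := h
      omega
  obtain ⟨hr', hrd⟩ := hrn
  have hN : (m : ℤ) * r = ((m * (n / 2) : ℕ) : ℤ) := by rw [hr']; push_cast; ring
  have hmn : (m : ℤ) * n = ((m * n : ℕ) : ℤ) := by push_cast; ring
  obtain ⟨h1, h2, h3⟩ := WeavingTrace.signedPoly_weavingWord k (n := n) hm
  refine ⟨WeavingTrace.toLaurent (m * (n / 2))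
    (WeavingTrace.signedPoly k n [] (WeavingTrace.weavingWord n m)), ?_, ?_, ?_⟩
  · intro K _ _ q hq z
    refine ⟨WeavingTrace.existsUnique_isOcneanuTrace hq z, fun Tr hTr => ?_⟩
    have h := WeavingTrace.trace_signedWord (k := k) (n := n) hq z hTr
      (WeavingTrace.weavingWord n m) [] (by simp)
      fun x hx => ((WeavingTrace.mem_weavingWord hm).1 hx).1
    rw [WeavingTrace.word_nil, one_mul] at h
    rw [WeavingTrace.rho_weavingBraid, map_smul, h, WeavingTrace.eval_toLaurent hq, smul_eq_mul]
  · rw [hN, hmn]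
    refine ⟨WeavingTrace.mem_degrees_toLaurent.2 ⟨_, h3, rfl⟩, fun s hs => ?_⟩
    obtain ⟨e, he, rfl⟩ := WeavingTrace.mem_degrees_toLaurent.1 hs
    have := (h1 e he).2
    omega
  · rw [hN, hrd]
    refine ⟨WeavingTrace.mem_degrees_toLaurent.2 ⟨_, h2, rfl⟩, fun s hs => ?_⟩
    obtain ⟨e, he, rfl⟩ := WeavingTrace.mem_degrees_toLaurent.1 hs
    have := (h1 e he).1
    omega
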